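/- **Corollary (boundary partition function and the Lam embedding).** Let $n\ge 1$. *Standard network.* Consider the chambers $(i,j)$, $0\le i\le j\le n$, where all the chambers $(i,i)$ are identified with $(0,0)$. The standard graph $\Sigma_n$ has the chambers with $i+j$ even as vertices, those with $i+j$ odd as faces, and one edge $e_{ij}$ for each pair $1\le i<j\le n$. Around $e_{ij}$ lie the chambers $(i-1,j-1),(i,j)$ on one diagonal and $(i-1,j),(i,j-1)$ on the other; the two of even type are the ends of $e_{ij}$, the two of odd type are the faces on its sides. (The medial graph of $\Sigma_n$ consists of $n$ strands, any two of which cross once; strand $j$ joins the points $j$ and $n+j$ among $2n$ points placed clockwise on a circle, and $e_{ij}$ is the crossing of the strands $i$ and $j$.) For $0\le k<2n$ put $r_k=(\max(k-n,0),\min(k,n))$, the chamber that meets the circle between the points $k$ and $k+1$ (the point $0$ being the point $2n$). The $i$-th boundary vertex of $\Sigma_n$ is $r_{2i-2}$, and the face between the $i$-th and the $(i+1)$-st boundary vertices is $r_{2i-1}$. The parameters are the conductivities $c=(c_{ij})_{i<j}$ of the edges. *Boundary partition function.* Let $\varphi_{ij}(t)$ be the $n\times n$ matrix that is $\begin{pmatrix}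 t&1+t\\ 1-t&-t\end{pmatrix}$ in the rows and columns $i<j$ and the identity elsewhere. Put $t_{ij}=c_{ij}$ if $i+j$ is odd and $t_{ij}=-1/c_{ij}$ if $i+j$ is even. Then $M_B=M_B(c)$ is the product of all $\varphi_{ij}(t_{ij})$ in the order $(n-1,n),(n-2,n),(n-2,n-1),(n-3,n),\dots,(1,n),\dots,(1,2)$. Let $S_m$ be the $m\times m$ matrix $S_m=\big(\delta_{i,j}-\delta_{i,\,j+1 \bmod m}\big)_{i,j}$, and let $T_{2n}$ be the permutation matrix for which right multiplication moves the columns $1,3,\dots,2n-1$ to the places $1,2,\dots,n$ and the columns $2,4,\dots,2n-2,2n$ to the places $n+2,n+3,\dots,2n,n+1$. Let $W_2=W_2(c)\subset\mathbb R^{2n}$ be the row space of $(M_B,\mathrm{Id}_n)\,S_{2n}T_{2n}$. *Symplectic space.* Let $\lambda_{2n}=\begin{pmatrix}0&g\\-g^T&0\end{pmatrix}$, where $g$ is the lower triangular $n\times n$ matrix with all entries on and below the diagonal equal to $1$, and let $V'=\{v\in\mathbb R^{2n}:\ \sum_{i=1}^n v_i=0=\sum_{i=n+1}^{2n}v_i\}$.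 $\mathrm{LG}(n-1,V')$ is the set of maximal isotropic subspaces of $(V',\lambda_{2n}|_{V'})$, of dimension $n-1$. *Lam embedding.* Let $N(\Sigma_n,c)$ be the bipartite network with a black interior vertex $b_v$ for each vertex $v$ of $\Sigma_n$, a black interior vertex $b_F$ for each face $F$, a white interior vertex $w_e$ for each edge $e$, and $2n$ white boundary vertices $1,\dots,2n$. The vertex $w_e$ is joined to $b_v$ for each end $v$ of $e$ by an edge of weight $c_e$, and to $b_F$ for each face $F$ on a side of $e$ by an edge of weight $1$; the boundary vertex $k$ is joined by an edge of weight $1$ to the black vertex of the chamber $r_{k-1}$. An almost perfect matching is a set of edges such that each interior vertex lies on exactly one of them. For $I\subset\{1,\dots,2n\}$ with $|I|=n-1$ let $\Delta_I(c)$ be the sum, over the almost perfect matchings for which $I$ is the set of boundary vertices that lie on no edge of the matching, of the product of the weights of the edges in the matching. The Lam embedding sends the network $(\Sigma_n,c)$ to the point $X(c)\in\mathrm{Gr}(n-1,2n)$ with Plücker coordinates $(\Delta_I(c))_I$. *Statement.* 1. For all nonzero real values of the parameters $c_{ij}$ (in particular for all conductivities $c_{ij}>0$) the subspace $W_2(c)$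 is a point of $\mathrm{LG}(n-1,V')$. 2. Let $\overline T_{2n}$ be the $2n\times 2n$ signed permutation matrix whose row $2i-1$ has the entry $(-1)^{i+1}$ in the column $n+i$ and whose row $2i$ has the entry $(-1)^{i+1}$ in the column $i$, for $i=1,\dots,n$. It is invertible, and for all conductivities $c_{ij}>0$ the numbers $\Delta_I(c)$ are the Plücker coordinates of a unique point $X(c)\in\mathrm{Gr}(n-1,2n)$, and $$X(c)\,\overline T_{2n}=W_2(c).$$ Thus the two presentations $c\mapsto X(c)$ and $c\mapsto W_2(c)$ of the networks on $\Sigma_n$ in $\mathrm{Gr}(n-1,2n)\subset\mathbb P(\bigwedge^{n-1}\mathbb R^{2n})$ differ by the automorphism $v\mapsto v\overline T_{2n}$ of $\mathbb R^{2n}$. -/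

import Mathlib

open scoped BigOperators

noncomputable section

namespace ElectricalLG

/-! ### Bipartite networks, almost perfect matchings and boundary measurements -/

/-- A bipartite network with boundary vertices `Fin m`, interior vertices `U` and edges `E`.
Every edge has a black and a white end; every boundary vertex has degree one, and its edge has
weight one. -/
structure BipartiteNetwork (m : ℕ) (U E : Type) where
  IsBlack : Fin m ⊕ U → Prop
  blackEnd : E → Fin m ⊕ U
  whiteEnd : E → Fin m ⊕ U
  weight : E → ℝ
  black_blackEnd : ∀ x, IsBlack (blackEnd x)
  white_whiteEnd : ∀ x, ¬ IsBlack (whiteEnd x)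
  degree_boundary : ∀ k : Fin m, ∃! x, blackEnd x = Sum.inl k ∨ whiteEnd x = Sum.inl k
  weight_boundary : ∀ (k : Fin m) (x : E),
    (blackEnd x = Sum.inl k ∨ whiteEnd x = Sum.inl k) → weight x = 1

/-- The edge `x` is incident to the vertex `v`. -/
def BipartiteNetwork.Incident {m : ℕ} {U E : Type} (N : BipartiteNetwork m U E)
    (x : E) (v : Fin m ⊕ U) : Prop :=
  N.blackEnd x = v ∨ N.whiteEnd x = v

/-- Almost perfect matchings: every interior vertex lies on exactly one edge of `P` (a boundary
vertex has degree one, so it lies on at most one edge of `P` anyway). -/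
def BipartiteNetwork.IsAlmostPerfect {m : ℕ} {U E : Type} (N : BipartiteNetwork m U E)
    (P : Finset E) : Prop :=
  ∀ u : U, ∃! x, x ∈ P ∧ N.Incident x (Sum.inr u)

/-- The matching `P` has boundary set `I`: the black boundary vertices on an edge of `P` are those
in `I`, and the white boundary vertices on no edge of `P` are those in `I`. -/
def BipartiteNetwork.HasBoundary {m : ℕ} {U E : Type} (N : BipartiteNetwork m U E)
    (P : Finset E) (I : Finset (Fin m)) : Prop :=
  ∀ k : Fin m,
    (N.IsBlack (Sum.inl k) → (k ∈ I ↔ ∃ x ∈ P, N.Incident x (Sum.inl k))) ∧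
    (¬ N.IsBlack (Sum.inl k) → (k ∈ I ↔ ¬ ∃ x ∈ P, N.Incident x (Sum.inl k)))

open Classical in
/-- The boundary measurement `Δ_I`: the sum of the weights of the almost perfect matchings with
boundary set `I`. -/
def BipartiteNetwork.boundaryMeasurement {m : ℕ} {U E : Type} [Fintype E]
    (N : BipartiteNetwork m U E) (I : Finset (Fin m)) : ℝ :=
  ∑ P : Finset E, if N.IsAlmostPerfect P ∧ N.HasBoundary P I then ∏ x ∈ P, N.weight x else 0

/-! ### Electrical networks in a disk and their bipartite networks -/

/-- The combinatorial data of an electrical network in a disk with `n` boundary vertices: vertices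
`V`, faces `F`, edges `E`; the two ends of an edge, the faces on its two sides, the boundary
vertices in cyclic order, the face that meets the boundary circle between the boundary vertices
`i` and `i + 1`, and the conductivities. -/
structure DiskNetwork (n : ℕ) (V F E : Type) where
  vertexEnd : E → Bool → V
  faceSide : E → Bool → F
  bdryVertex : Fin n → V
  bdryFace : Fin n → F
  cond : E → ℝ

/-- The black interior vertex joined to a boundary vertex of the bipartite network. Counted from
`1`, the boundary vertex `2i - 1` is joined to `b_v` for the `i`-th boundary vertex `v`, and the
boundary vertex `2i` to `b_F` for the face `F` between the `i`-th and `(i+1)`-st ones. -/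
def DiskNetwork.bdryRegion {n : ℕ} {V F E : Type} (D : DiskNetwork n V F E)
    (k : Fin (2 * n)) : V ⊕ F :=
  if k.val % 2 = 0 then Sum.inl (D.bdryVertex ⟨k.val / 2, by omega⟩)
  else Sum.inr (D.bdryFace ⟨k.val / 2, by omega⟩)

/-- The bipartite network of an electrical network. Interior vertices: a black one `b_v` for each
vertex `v` and `b_F` for each face `F`, and a white one `w_e` for each edge `e`. Edges: `w_e` is
joined to `b_v` for the two ends `v` of `e`, with weight the conductivity of `e`, and to `b_F` for
the faces `F` on the two sides of `e`, with weight one; the `2n` boundary vertices, which are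
white, are joined to the boundary vertices and boundary faces with weight one. -/
def DiskNetwork.bipartite {n : ℕ} {V F E : Type} (D : DiskNetwork n V F E) :
    BipartiteNetwork (2 * n) ((V ⊕ F) ⊕ E) ((E × Bool) ⊕ (E × Bool) ⊕ Fin (2 * n)) where
  IsBlack := Sum.elim (fun _ => False) (Sum.elim (fun _ => True) (fun _ => False))
  blackEnd := Sum.elim (fun x => Sum.inr (Sum.inl (Sum.inl (D.vertexEnd x.1 x.2))))
    (Sum.elim (fun x => Sum.inr (Sum.inl (Sum.inr (D.faceSide x.1 x.2))))
      (fun k => Sum.inr (Sum.inl (D.bdryRegion k))))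
  whiteEnd := Sum.elim (fun x => Sum.inr (Sum.inr x.1))
    (Sum.elim (fun x => Sum.inr (Sum.inr x.1)) (fun k => Sum.inl k))
  weight := Sum.elim (fun x => D.cond x.1) (fun _ => 1)
  black_blackEnd := by rintro (x | x | x) <;> simp
  white_whiteEnd := by rintro (x | x | x) <;> simp
  degree_boundary := by
    intro k
    refine ⟨Sum.inr (Sum.inr k), by simp, ?_⟩
    rintro (x | x | x) <;> simp
  weight_boundary := by
    rintro k (x | x | x) <;> simp

/-! ### Points of Grassmannians, the Lam embedding -/

/-- `X` is the `k`-dimensional subspace of `ℝ^m` whose Plücker coordinates are the numbers `Δ I`,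
`|I| = k`, up to a common nonzero factor. -/
def HasPluckerCoordinates {m : ℕ} (k : ℕ) (X : Submodule ℝ (Fin m → ℝ))
    (Δ : Finset (Fin m) → ℝ) : Prop :=
  ∃ A : Matrix (Fin k) (Fin m) ℝ,
    LinearIndependent ℝ A.row ∧ Submodule.span ℝ (Set.range A.row) = X ∧
    ∃ s : ℝ, s ≠ 0 ∧ ∀ (I : Finset (Fin m)) (hI : I.card = k),
      (A.submatrix id (I.orderEmbOfFin hI)).det = s * Δ I

/-- `X` is the image of the electrical network `D` under the Lam embedding into
`Gr(n - 1, 2n)`. -/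
def IsLamPoint {n : ℕ} {V F E : Type} [Fintype E] (D : DiskNetwork n V F E)
    (X : Submodule ℝ (Fin (2 * n) → ℝ)) : Prop :=
  HasPluckerCoordinates (n - 1) X D.bipartite.boundaryMeasurement

/-! ### The standard graph

Its medial graph consists of `n` strands, each two of which cross once. Strand `j` runs down the
`j`-th column of a triangular array, turns on the diagonal and leaves to the right along the
`j`-th row, so strands `i < j` cross at the place `(i, j)`. Numbered clockwise, the ends of the
strands are `1, …, n` on the top side and `n + 1, …, 2n` on the right side, and strand `j` joins
the ends `j` and `n + j`. The chamber `(i, j)`, `0 ≤ i ≤ j ≤ n`, is the one between rows `i` and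
`i + 1` and between columns `j` and `j + 1`; all the chambers `(i, i)` are one and the same, the
one between the ends `2n` and `1`, written `(0, 0)`. The chambers with `i + j` even are the
vertices of the standard graph, those with `i + j` odd are its faces and the crossings are its
edges. -/

/-- Crossings of the strands, that is, edges of the standard graph. -/
abbrev StdEdge (n : ℕ) : Type := {p : Fin n × Fin n // p.1 < p.2}

/-- Vertices of the standard graph. -/
abbrev StdVertex (n : ℕ) : Type :=
  {p : ℕ × ℕ // ((p.1 < p.2 ∧ p.2 ≤ n) ∨ p = (0, 0)) ∧ Even (p.1 + p.2)}

/-- Faces of the standard graph. -/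
abbrev StdFace (n : ℕ) : Type :=
  {p : ℕ × ℕ // (p.1 < p.2 ∧ p.2 ≤ n) ∧ Odd (p.1 + p.2)}

/-- The chamber `(i, j)` as a vertex. -/
def stdVertex {n : ℕ} (i j : ℕ) (_hij : i ≤ j) (hj : j ≤ n) (he : Even (i + j)) : StdVertex n :=
  if h : i < j then ⟨(i, j), Or.inl ⟨h, hj⟩, he⟩ else ⟨(0, 0), Or.inr rfl, by simp⟩

/-- The chamber `(i, j)` as a face. -/
def stdFace {n : ℕ} (i j : ℕ) (hij : i ≤ j) (hj : j ≤ n) (ho : Odd (i + j)) : StdFace n :=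
  ⟨(i, j), ⟨by rcases ho with ⟨r, hr⟩; omega, hj⟩, ho⟩

/-- The standard network with conductivities `c`. The strands with (zero based) numbers `i < j`
cross between the chambers `(i, j)`, `(i + 1, j + 1)` on one diagonal and `(i, j + 1)`,
`(i + 1, j)` on the other. For `i + j` even the edge joins the former two, which are vertices, and
the latter two are the faces on its sides; for `i + j` odd it is the other way round. The chamber
between the strand ends `k` and `k + 1`, where `0 ≤ k < 2n`, is `(k - n, min k n)` (with truncated
subtraction). -/
def stdNetwork (n : ℕ) (c : StdEdge n → ℝ) :
    DiskNetwork n (StdVertex n) (StdFace n) (StdEdge n) where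
  vertexEnd e b :=
    if h : Even (e.1.1.val + e.1.2.val) then
      if b then
        stdVertex e.1.1 e.1.2 (by have := e.2; omega) (by omega) h
      else
        stdVertex (e.1.1 + 1) (e.1.2 + 1) (by have := e.2; omega) (by omega)
          (by rw [Nat.even_iff] at *; omega)
    else
      if b then
        stdVertex e.1.1 (e.1.2 + 1) (by have := e.2; omega) (by omega)
          (by rw [Nat.even_iff] at *; omega)
      else
        stdVertex (e.1.1 + 1) e.1.2 (by have := e.2; omega) (by omega)
          (by rw [Nat.even_iff] at *; omega)
  faceSide e b :=
    if h : Even (e.1.1.val + e.1.2.val) then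
      if b then
        stdFace e.1.1 (e.1.2 + 1) (by have := e.2; omega) (by omega)
          (by rw [Nat.even_iff] at h; rw [Nat.odd_iff]; omega)
      else
        stdFace (e.1.1 + 1) e.1.2 (by have := e.2; omega) (by omega)
          (by rw [Nat.even_iff] at h; rw [Nat.odd_iff]; omega)
    else
      if b then
        stdFace e.1.1 e.1.2 (by have := e.2; omega) (by omega)
          (by rw [Nat.even_iff] at h; rw [Nat.odd_iff]; omega)
      else
        stdFace (e.1.1 + 1) (e.1.2 + 1) (by have := e.2; omega) (by omega)
          (by rw [Nat.even_iff] at h; rw [Nat.odd_iff]; omega)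
  bdryVertex i := stdVertex (2 * i - n) (min (2 * i) n) (by omega) (by omega)
    (by rw [Nat.even_iff]; omega)
  bdryFace i := stdFace (2 * i + 1 - n) (min (2 * i + 1) n) (by omega) (by omega)
    (by rw [Nat.odd_iff]; omega)
  cond := c

/-! ### The boundary partition function -/

/-- The vertex weight with parameter `t` at the crossing of the strands `i` and `j`: the matrix
`[[t, 1 + t], [1 - t, -t]]` in the rows and columns `i, j`, and the identity elsewhere. -/
def vertexWeight {n : ℕ} (i j : Fin n) (t : ℝ) : Matrix (Fin n) (Fin n) ℝ :=
  Matrix.of fun k l =>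
    if k = i ∧ l = i then t
    else if k = i ∧ l = j then 1 + t
    else if k = j ∧ l = i then 1 - t
    else if k = j ∧ l = j then -t
    else if k = l then 1 else 0

/-- The parameter of the crossing of the strands `i < j` (zero based). An edge of the medial
graph carries the difference of the voltage of the vertex and the current potential of the face
that it separates; Ohm's law for conductivity `c` expresses the two outgoing values at a crossing
through the two incoming ones by the vertex weight with parameter `c` or `-1 / c`, according to
which pair of opposite chambers are the vertices. -/
def vertexParameter {n : ℕ} (c : StdEdge n → ℝ) (e : StdEdge n) : ℝ :=
  if Even (e.1.1.val + e.1.2.val) then -1 / c e else c e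

/-- The boundary partition function `M_B` of the standard network: the product of the vertex
weights over all the crossings, in the order in which strands that start at the ends
`n + 1, …, 2n` meet them: `(n-1, n)`, `(n-2, n)`, `(n-2, n-1)`, `(n-3, n)`, …, `(1, 2)`. -/
def boundaryPartition (n : ℕ) (c : StdEdge n → ℝ) : Matrix (Fin n) (Fin n) ℝ :=
  ((List.finRange n).reverse.map fun i =>
    ((List.finRange n).reverse.map fun j =>
      if h : i < j then vertexWeight i j (vertexParameter c ⟨(i, j), h⟩) else 1).prod).prod

/-! ### The subspace `W₂` -/

/-- The matrix `S_m`: `1` on the diagonal, `-1` just below it and `-1` in the upper right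
corner. -/
def cyclicDiff (m : ℕ) : Matrix (Fin m) (Fin m) ℝ :=
  Matrix.of fun i j =>
    (if i = j then 1 else 0) - (if i.val = (j.val + 1) % m then 1 else 0)

/-- The permutation matrix `T_{2n}`, which moves the odd columns `1, 3, …, 2n - 1` to the places
`1, …, n` and the even columns `2, 4, …, 2n - 2, 2n` to the places `n + 2, n + 3, …, 2n, n + 1`. -/
def shuffle (n : ℕ) : Matrix (Fin (2 * n)) (Fin (2 * n)) ℝ :=
  Matrix.of fun k l =>
    if k.val % 2 = 0 then (if l.val = k.val / 2 then 1 else 0)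
    else (if l.val = n + (k.val / 2 + 1) % n then 1 else 0)

/-- The `n × 2n` matrix `(M, Id)`. -/
def appendId {n : ℕ} (M : Matrix (Fin n) (Fin n) ℝ) : Matrix (Fin n) (Fin (2 * n)) ℝ :=
  Matrix.of fun i k => if h : k.val < n then M i ⟨k.val, h⟩ else if k.val = n + i.val then 1 else 0

/-- The subspace `W₂`, the row space of `(M_B, Id) S_{2n} T_{2n}`. -/
def W₂ (n : ℕ) (c : StdEdge n → ℝ) : Submodule ℝ (Fin (2 * n) → ℝ) :=
  Submodule.span ℝ
    (Set.range (appendId (boundaryPartition n c) * cyclicDiff (2 * n) * shuffle n).row)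

/-! ### The symplectic space `V'` and the matrix `T̄` -/

/-- The matrix of the form `λ_{2n}`: the blocks are `0, g, -gᵀ, 0`, where `g` is the lower
triangular matrix with all entries on and below the diagonal equal to `1`. -/
def lambdaForm (n : ℕ) : Matrix (Fin (2 * n)) (Fin (2 * n)) ℝ :=
  Matrix.of fun k l =>
    if k.val < n ∧ n ≤ l.val ∧ l.val - n ≤ k.val then 1
    else if l.val < n ∧ n ≤ k.val ∧ k.val - n ≤ l.val then -1
    else 0

/-- The subspace `V'`: the first `n` coordinates sum to zero, and so do the last `n`. -/
def V' (n : ℕ) : Submodule ℝ (Fin (2 * n) → ℝ) where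
  carrier := {v | ∑ k with k.val < n, v k = 0 ∧ ∑ k with n ≤ k.val, v k = 0}
  add_mem' := by
    rintro a b ⟨h1, h2⟩ ⟨h3, h4⟩
    simp [Finset.sum_add_distrib, h1, h2, h3, h4]
  zero_mem' := by simp
  smul_mem' := by
    rintro r a ⟨h1, h2⟩
    simp [← Finset.mul_sum, h1, h2]

/-- A subspace on which the form with matrix `ω` vanishes. -/
def IsIsotropic {m : ℕ} (ω : Matrix (Fin m) (Fin m) ℝ) (W : Submodule ℝ (Fin m → ℝ)) : Prop :=
  ∀ x ∈ W, ∀ y ∈ W, x ⬝ᵥ (ω.mulVec y) = 0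

/-- `LG(d, V)` for the restriction to `V` of the form with matrix `ω`: the maximal isotropic
subspaces of `V`, of dimension `d`. -/
def lagrangianGrassmannian {m : ℕ} (ω : Matrix (Fin m) (Fin m) ℝ) (d : ℕ)
    (V : Submodule ℝ (Fin m → ℝ)) : Set (Submodule ℝ (Fin m → ℝ)) :=
  {W | W ≤ V ∧ IsIsotropic ω W ∧ Module.finrank ℝ W = d ∧
    ∀ W' : Submodule ℝ (Fin m → ℝ), W ≤ W' → W' ≤ V → IsIsotropic ω W' → W' = W}

/-- The signed permutation matrix `T̄_{2n}`: counted from `1`, the row `2i - 1` has the entry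
`(-1)^(i+1)` in the column `n + i`, and the row `2i` has the entry `(-1)^(i+1)` in the
column `i`. -/
def signedShuffle (n : ℕ) : Matrix (Fin (2 * n)) (Fin (2 * n)) ℝ :=
  Matrix.of fun k l =>
    if k.val % 2 = 0 then (if l.val = n + k.val / 2 then (-1) ^ (k.val / 2) else 0)
    else (if l.val = k.val / 2 then (-1) ^ (k.val / 2) else 0)

end ElectricalLG

end

/-!
The standard network can be built from the network without crossings by adding the crossings one at
a time, at the side of the disk that carries the first `n` strand ends, in exactly the order in
which the vertex weights occur in the product `M_B`. The crossing `(i, j)` is added between the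
places `j - i - 1` and `j - i` (counted from `0`), so the seam between the boundary vertices `2n`
and `1` is never touched. Both presentations of the network change by the same column operation.

* On the side of `W₂`: let `v` run through the vectors of values at the `2n` strand ends, that is,
  the row space of `(M, Id)` with the columns permuted by the strands, and let `δ k = v (k - 1) - v
  k` be the differences at the boundary vertices. A crossing with parameter `t` at the boundary
  vertex `a` adds `t δ_a` to `δ (a - 1)` and `-t δ_a` to `δ (a + 1)` (`strandRow_step`,
  `bdryDiff_eq_crossingMap`). This is a transvection that preserves the symplectic form and the sums
  over the odd and the even places (`diffForm_crossingMap`, `crossingMap_dotProduct_parityVec`).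
  With the signs `(-1)^⌊k/2⌋` it becomes the addition of `β` times the column `a` to both
  neighbouring columns, where `β` is the conductivity or its inverse.
* On the side of matchings: the boundary measurements are coefficients of a product of linear forms,
  one for each white vertex (`DiskNetwork.boundaryMeasurement_eq_coeff`), and a new crossing, a new
  factor, changes them as the same column operation changes the maximal minors of a matrix
  (`matchingSum_addCrossing`, `maxMinor_addNeighbours`, `maxMinor_crossingMap`).

Without crossings the strands are `n` nested arcs, the differences are spanned by the vectors `e_m -
e_{2n - m}`, and with the column signs their maximal minors are, up to a common sign, the indicator
function of the transversals of the pairs `{m, 2n - m}`, which is also what the matchings count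
(`det_nested`, `builtMeasurement_self`). The structure `IsBuiltBasis` carries all the invariants
through the induction, and `exists_isBuiltBasis` is the outcome: a matrix from which bases of `X`
and of `W₂` arise by changing signs of columns and by permuting columns. Maximality of `W₂` is the
bound for the dimension of isotropic subspaces, as the form is nondegenerate on `V'`
(`lambdaForm_separating`), and uniqueness of `X` holds because a subspace is determined by its
Plücker coordinates (`HasPluckerCoordinates.unique`).
-/

noncomputable section

namespace ElectricalLG

/-! ### Maximal minors -/

/-- The maximal minor of `A` in the columns `I`, taken in increasing order; by convention `0` when
`I` does not have as many elements as `A` has rows. -/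
def maxMinor {k m : ℕ} (A : Matrix (Fin k) (Fin m) ℝ) (I : Finset (Fin m)) : ℝ :=
  if h : I.card = k then (A.submatrix id (I.orderEmbOfFin h)).det else 0

theorem maxMinor_of_card {k m : ℕ} (A : Matrix (Fin k) (Fin m) ℝ) {I : Finset (Fin m)}
    (h : I.card = k) : maxMinor A I = (A.submatrix id (I.orderEmbOfFin h)).det := dif_pos h

theorem maxMinor_eq_det_of_strictMono {k m : ℕ} (A : Matrix (Fin k) (Fin m) ℝ) {f : Fin k → Fin m}
    (hf : StrictMono f) {I : Finset (Fin m)} (hI : Finset.univ.image f = I) :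
    maxMinor A I = (A.submatrix id f).det := by
  subst hI
  have hc : (Finset.univ.image f).card = k := by
    rw [Finset.card_image_of_injective _ hf.injective, Finset.card_fin]
  rw [maxMinor_of_card A hc, ← Finset.orderEmbOfFin_unique hc (f := f) (by simp) hf]

theorem exists_maxMinor_ne_zero {k m : ℕ} (A : Matrix (Fin k) (Fin m) ℝ)
    (hA : LinearIndependent ℝ A.row) : ∃ I : Finset (Fin m), I.card = k ∧ maxMinor A I ≠ 0 := by
  obtain ⟨κ, a, ha, hspan, hli⟩ := exists_linearIndependent' ℝ A.col
  have : Finite κ := Finite.of_injective a ha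
  have : Fintype κ := Fintype.ofFinite κ
  have hrank : Module.finrank ℝ (Submodule.span ℝ (Set.range A.col)) = k := by
    rw [← Matrix.rank_eq_finrank_span_cols, LinearIndependent.rank_matrix hA, Fintype.card_fin]
  have hκ : Fintype.card κ = k := by
    rw [← hrank, ← hspan, finrank_span_eq_card hli]
  have hcard : (Finset.univ.image a).card = k := by
    rw [Finset.card_image_of_injective _ ha, Finset.card_univ, hκ]
  refine ⟨_, hcard, ?_⟩
  rw [maxMinor_of_card A hcard]
  have hmem : ∀ s, ∃ x, a x = (Finset.univ.image a).orderEmbOfFin hcard s := fun s => by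
    obtain ⟨x, -, hx⟩ := Finset.mem_image.1 (Finset.orderEmbOfFin_mem _ hcard s)
    exact ⟨x, hx⟩
  choose g hg using hmem
  have hginj : Function.Injective g := fun s t hst => by
    have := hg s
    rw [hst, hg t] at this
    exact ((Finset.orderEmbOfFin _ hcard).injective this).symm
  have hli' := hli.comp g hginj
  have : LinearIndependent ℝ (A.submatrix id ((Finset.univ.image a).orderEmbOfFin hcard)).col := by
    have hcol : (A.submatrix id ((Finset.univ.image a).orderEmbOfFin hcard)).col =
        (A.col ∘ a) ∘ g := by
      funext s r
      simp only [Matrix.col_apply, Matrix.submatrix_apply, id, ← hg, Function.comp_apply]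
    rw [hcol]
    exact hli'
  rw [Matrix.linearIndependent_cols_iff_isUnit, Matrix.isUnit_iff_isUnit_det] at this
  exact this.ne_zero

/-- Expansion of a minor along an additional first row. -/
theorem maxMinor_cons {k m : ℕ} (A : Matrix (Fin k) (Fin m) ℝ) (v : Fin m → ℝ)
    {J : Finset (Fin m)} (hJ : J.card = k + 1) :
    maxMinor (Matrix.of (Fin.cons v A : Fin (k + 1) → Fin m → ℝ)) J =
      ∑ j : Fin (k + 1), (-1) ^ (j : ℕ) * v (J.orderEmbOfFin hJ j) *
        maxMinor A (J.erase (J.orderEmbOfFin hJ j)) := by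
  rw [maxMinor_of_card _ hJ, Matrix.det_succ_row_zero]
  refine Finset.sum_congr rfl fun j _ => ?_
  have hmono : StrictMono fun s : Fin k => J.orderEmbOfFin hJ (j.succAbove s) :=
    (J.orderEmbOfFin hJ).strictMono.comp (Fin.strictMono_succAbove j)
  rw [maxMinor_eq_det_of_strictMono A hmono]
  · rfl
  · ext x
    simp only [Finset.mem_image, Finset.mem_univ, true_and, Finset.mem_erase]
    constructor
    · rintro ⟨s, rfl⟩
      exact ⟨fun h => Fin.succAbove_ne j s ((J.orderEmbOfFin hJ).injective h),
        Finset.orderEmbOfFin_mem _ _ _⟩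
    · rintro ⟨hx, hxJ⟩
      have : x ∈ Set.range (J.orderEmbOfFin hJ) := by
        rw [Finset.range_orderEmbOfFin]; exact hxJ
      obtain ⟨i, rfl⟩ := this
      obtain ⟨s, rfl⟩ := Fin.exists_succAbove_eq (x := i) (y := j) (fun h => hx (by rw [h]))
      exact ⟨s, rfl⟩

theorem mem_span_row_iff {k m : ℕ} (A : Matrix (Fin k) (Fin m) ℝ) (hA : LinearIndependent ℝ A.row)
    (v : Fin m → ℝ) :
    v ∈ Submodule.span ℝ (Set.range A.row) ↔ ∀ J : Finset (Fin m), J.card = k + 1 →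
      maxMinor (Matrix.of (Fin.cons v A : Fin (k + 1) → Fin m → ℝ)) J = 0 := by
  have hiff : LinearIndependent ℝ
      (Matrix.of (Fin.cons v A : Fin (k + 1) → Fin m → ℝ)).row ↔
      v ∉ Submodule.span ℝ (Set.range A.row) := by
    refine Iff.trans (linearIndependent_finCons (K := ℝ) (x := v) (v := A.row)) ?_
    simp [hA]
  constructor
  · intro hv J hJ
    by_contra hne
    rw [maxMinor_of_card _ hJ] at hne
    have hu := (Matrix.isUnit_iff_isUnit_det _).2 (isUnit_iff_ne_zero.2 hne)
    rw [← Matrix.linearIndependent_rows_iff_isUnit] at hu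
    refine hiff.1 ?_ hv
    exact LinearIndependent.of_comp (LinearMap.funLeft ℝ ℝ (J.orderEmbOfFin hJ)) hu
  · intro h
    by_contra hv
    obtain ⟨J, hJ, hne⟩ := exists_maxMinor_ne_zero _ (hiff.2 hv)
    exact hne (h J hJ)

/-- A point of the Grassmannian is determined by its Plücker coordinates. -/
theorem HasPluckerCoordinates.unique {m k : ℕ} {X Y : Submodule ℝ (Fin m → ℝ)}
    {Δ : Finset (Fin m) → ℝ} (hX : HasPluckerCoordinates k X Δ)
    (hY : HasPluckerCoordinates k Y Δ) : X = Y := by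
  obtain ⟨A, hA, rfl, s, hs, hAs⟩ := hX
  obtain ⟨B, hB, rfl, t, ht, hBt⟩ := hY
  ext v
  rw [mem_span_row_iff A hA, mem_span_row_iff B hB]
  refine forall₂_congr fun J hJ => ?_
  have key : ∀ (C : Matrix (Fin k) (Fin m) ℝ) (u : ℝ),
      (∀ (I : Finset (Fin m)) (hI : I.card = k),
        (C.submatrix id (I.orderEmbOfFin hI)).det = u * Δ I) →
      maxMinor (Matrix.of (Fin.cons v C : Fin (k + 1) → Fin m → ℝ)) J =
        u * ∑ j : Fin (k + 1), (-1) ^ (j : ℕ) * v (J.orderEmbOfFin hJ j) *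
          Δ (J.erase (J.orderEmbOfFin hJ j)) := by
    intro C u hC
    rw [maxMinor_cons C v hJ, Finset.mul_sum]
    refine Finset.sum_congr rfl fun j _ => ?_
    have hc : (J.erase (J.orderEmbOfFin hJ j)).card = k := by
      rw [Finset.card_erase_of_mem (Finset.orderEmbOfFin_mem _ _ _), hJ]; rfl
    rw [maxMinor_of_card C hc, hC _ hc]
    ring
  rw [key A s hAs, key B t hBt]
  simp [hs, ht]

/-- Adding `β` times the column `a` to the neighbouring column `b`. -/
theorem maxMinor_addColumn {k m : ℕ} (A B : Matrix (Fin k) (Fin m) ℝ) (β : ℝ) (a b : Fin m)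
    (hab : a.val + 1 = b.val ∨ b.val + 1 = a.val)
    (hB : ∀ r l, B r l = A r l + if l = b then β * A r a else 0) (I : Finset (Fin m))
    (hI : I.card = k) :
    maxMinor B I = maxMinor A I +
      if b ∈ I ∧ a ∉ I then β * maxMinor A (insert a (I.erase b)) else 0 := by
  have hne : a ≠ b := by rintro rfl; omega
  set f := I.orderEmbOfFin hI with hf
  rw [maxMinor_of_card A hI, maxMinor_of_card B hI, ← hf]
  by_cases hb : b ∈ I
  · obtain ⟨s, hs⟩ : ∃ s, f s = b := by
      have : b ∈ Set.range f := by rw [hf, Finset.range_orderEmbOfFin]; exact hb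
      exact this
    have hcol : B.submatrix id f =
        (A.submatrix id f).updateCol s ((fun r => A r b) + β • fun r => A r a) := by
      ext r t
      by_cases ht : t = s
      · subst ht; simp [hB, hs]
      · have : f t ≠ b := fun h => ht (f.injective (h.trans hs.symm))
        simp [hB, this, Matrix.updateCol_ne ht]
    have hself : (A.submatrix id f).updateCol s (fun r => A r b) = A.submatrix id f := by
      ext r t
      by_cases ht : t = s
      · subst ht; simp [hs]
      · simp [Matrix.updateCol_ne ht]
    rw [hcol, Matrix.det_updateCol_add, Matrix.det_updateCol_smul, hself]
    congr 1
    by_cases ha : a ∈ I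
    · obtain ⟨s', hs'⟩ : ∃ s, f s = a := by
        have : a ∈ Set.range f := by rw [hf, Finset.range_orderEmbOfFin]; exact ha
        exact this
      have hss : s ≠ s' := by rintro rfl; exact hne (hs'.symm.trans hs)
      rw [if_neg (by simp [ha]), Matrix.det_zero_of_column_eq hss, mul_zero]
      intro r
      simp [Matrix.updateCol_ne hss.symm, hs']
    · rw [if_pos ⟨hb, ha⟩]
      have hval : ∀ t, t ≠ s → f t ≠ a ∧ f t ≠ b := fun t ht =>
        ⟨fun h => ha (h ▸ Finset.orderEmbOfFin_mem I hI t),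
          fun h => ht (f.injective (h.trans hs.symm))⟩
      have hmono : StrictMono (Function.update f s a) := by
        intro t u htu
        by_cases ht : t = s
        · subst ht
          have hu : u ≠ t := htu.ne'
          rw [Function.update_self, Function.update_of_ne hu]
          have h1 : f t < f u := f.strictMono htu
          have h2 := hval u hu
          rw [hs] at h1
          rw [Fin.lt_def] at h1 ⊢
          have h3 : (f u).val ≠ a.val := fun h => h2.1 (Fin.ext h)
          omega
        · by_cases hu : u = s
          · subst hu
            rw [Function.update_self, Function.update_of_ne ht]
            have h1 : f t < f u := f.strictMono htu
            have h2 := hval t ht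
            rw [hs] at h1
            rw [Fin.lt_def] at h1 ⊢
            have h3 : (f t).val ≠ a.val := fun h => h2.1 (Fin.ext h)
            omega
          · rw [Function.update_of_ne ht, Function.update_of_ne hu]
            exact f.strictMono htu
      rw [maxMinor_eq_det_of_strictMono A hmono]
      · congr 2
        ext r t
        by_cases ht : t = s
        · subst ht; simp
        · simp [Matrix.updateCol_ne ht, Function.update_of_ne ht]
      · ext x
        simp only [Finset.mem_image, Finset.mem_univ, true_and, Finset.mem_insert,
          Finset.mem_erase]
        constructor
        · rintro ⟨t, rfl⟩
          by_cases ht : t = s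
          · subst ht; simp
          · rw [Function.update_of_ne ht]
            exact Or.inr ⟨(hval t ht).2, Finset.orderEmbOfFin_mem I hI t⟩
        · rintro (rfl | ⟨hxb, hx⟩)
          · exact ⟨s, by simp⟩
          · have : x ∈ Set.range f := by rw [hf, Finset.range_orderEmbOfFin]; exact hx
            obtain ⟨t, rfl⟩ := this
            refine ⟨t, ?_⟩
            rw [Function.update_of_ne]
            rintro rfl
            exact hxb hs
  · rw [if_neg (by simp [hb]), add_zero]
    congr 1
    ext r t
    have : f t ≠ b := fun h => hb (h ▸ Finset.orderEmbOfFin_mem I hI t)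
    simp [hB, this]

/-- Adding `β` times the column `a` to both neighbouring columns `p` and `q`. -/
theorem maxMinor_addNeighbours {k m : ℕ} (A B : Matrix (Fin k) (Fin m) ℝ) (β : ℝ) (p a q : Fin m)
    (hpa : p.val + 1 = a.val) (haq : a.val + 1 = q.val)
    (hB : ∀ r l, B r l = A r l + if l = p ∨ l = q then β * A r a else 0) (I : Finset (Fin m))
    (hI : I.card = k) :
    maxMinor B I = maxMinor A I +
      if a ∈ I then 0 else
        ((if p ∈ I then β * maxMinor A (insert a (I.erase p)) else 0) +
        if q ∈ I then β * maxMinor A (insert a (I.erase q)) else 0) := by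
  have hpq : p ≠ q := by rintro rfl; omega
  have hpa' : p ≠ a := by rintro rfl; omega
  have haq' : a ≠ q := by rintro rfl; omega
  let C : Matrix (Fin k) (Fin m) ℝ := fun r l => A r l + if l = p then β * A r a else 0
  have hCA := maxMinor_addColumn A C β a p (Or.inr hpa) (fun r l => rfl)
  have hBC := maxMinor_addColumn C B β a q (Or.inl haq) (fun r l => by
    rw [hB]
    by_cases h1 : l = p
    · subst h1; simp [C, hpq]
    · by_cases h2 : l = q
      · subst h2; simp [C, hpq.symm, hpa'.symm]
      · simp [C, h1, h2])
  rw [hBC I hI, hCA I hI]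
  by_cases ha : a ∈ I
  · simp [ha]
  · by_cases hq : q ∈ I
    · have hc : (insert a (I.erase q)).card = k := by
        rw [Finset.card_insert_of_notMem (by simp [ha]), Finset.card_erase_of_mem hq, hI]
        have : 0 < I.card := Finset.card_pos.2 ⟨q, hq⟩
        omega
      rw [hCA _ hc]
      by_cases hp : p ∈ I <;> simp [ha, hq, hp]; ring
    · by_cases hp : p ∈ I <;> simp [ha, hq, hp]

/-- A pairing of the labels `l 0 < l 1 < ⋯ < ρ 1 < ρ 0` by nested arcs, with alternating signs: the
minor in the columns `f 0 < f 1 < ⋯` is `1` if every arc has an end among them, and `0`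
otherwise. -/
theorem det_nested {m : ℕ} (l ρ f : Fin m → ℕ) (hl : StrictMono l) (hρ : StrictAnti ρ)
    (hlρ : ∀ r s, l r < ρ s) (hf : StrictMono f) :
    (Matrix.of fun r s : Fin m => (if f s = l r then (1 : ℝ) else 0) +
      (-1) ^ (m - 1 - r.val) * if f s = ρ r then 1 else 0).det =
      if ∀ r, ∃ s, f s = l r ∨ f s = ρ r then 1 else 0 := by
  induction m with
  | zero => simp
  | succ m ih =>
    split_ifs with h
    swap
    · push Not at h
      obtain ⟨r, hr⟩ := h
      exact Matrix.det_eq_zero_of_row_eq_zero r fun s => by simp [hr s]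
    choose g hg using h
    have hginj : Function.Injective g := by
      intro r r' hrr
      have h1 := hg r
      have h2 := hg r'
      rw [hrr] at h1
      rcases h1 with h1 | h1 <;> rcases h2 with h2 | h2
      · exact hl.injective (h1.symm.trans h2)
      · have := hlρ r r'; omega
      · have := hlρ r' r; omega
      · exact hρ.injective (h1.symm.trans h2)
    have hgsurj : Function.Surjective g := Finite.surjective_of_injective hginj
    have hrow : ∀ s, s ≠ g 0 → f s ≠ l 0 ∧ f s ≠ ρ 0 := by
      intro s hs
      obtain ⟨r, rfl⟩ := hgsurj s
      have hr : r ≠ 0 := fun h => hs (by rw [h])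
      have hr' : 0 < r := Fin.pos_of_ne_zero hr
      have h1 := hl hr'
      have h2 := hρ hr'
      have h3 := hlρ r 0
      have h4 := hlρ 0 r
      rcases hg r with h | h <;> constructor <;> omega
    rw [Matrix.det_succ_row_zero, Finset.sum_eq_single (g 0)]
    rotate_left
    · intro s _ hs
      simp [hrow s hs]
    · simp
    -- the arc of row `0` is the outermost one, so its column is the first or the last
    have hsub : ∀ c : Fin (m + 1), c = g 0 →
        ((Matrix.of fun r s : Fin (m + 1) => (if f s = l r then (1 : ℝ) else 0) +
          (-1) ^ (m + 1 - 1 - r.val) * if f s = ρ r then 1 else 0).submatrix Fin.succ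
            c.succAbove).det = 1 := by
      intro c hc
      have := ih (fun r => l r.succ) (fun r => ρ r.succ) (fun s => f (c.succAbove s))
        (fun a b hab => hl (Fin.succ_lt_succ_iff.2 hab))
        (fun a b hab => hρ (Fin.succ_lt_succ_iff.2 hab)) (fun r s => hlρ _ _)
        (hf.comp (Fin.strictMono_succAbove c))
      rw [if_pos] at this
      · refine Eq.trans (congrArg Matrix.det ?_) this
        ext r s
        have he : m + 1 - 1 - (r.val + 1) = m - 1 - r.val := by omega
        simp only [Matrix.submatrix_apply, Matrix.of_apply, Fin.val_succ, he]
      · intro r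
        have hne : g r.succ ≠ c := fun h => Fin.succ_ne_zero r (hginj (h.trans hc))
        obtain ⟨s, hs⟩ := Fin.exists_succAbove_eq hne
        exact ⟨s, by rw [hs]; exact hg r.succ⟩
    rw [hsub _ rfl, mul_one]
    have hvals : ∀ s, l 0 ≤ f s ∧ f s ≤ ρ 0 := by
      intro s
      obtain ⟨r, rfl⟩ := hgsurj s
      have h1 := hl.monotone (Fin.zero_le r)
      have h2 := hρ.antitone (Fin.zero_le r)
      have h3 := hlρ r 0
      have h4 := hlρ 0 r
      rcases hg r with h | h <;> omega
    have h00 := hlρ 0 0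
    rcases hg 0 with h | h
    · have hg0 : g 0 = 0 := by
        by_contra hne
        have := hf (Fin.pos_of_ne_zero hne)
        have := (hvals 0).1
        omega
      have hne : f 0 ≠ ρ 0 := by rw [hg0] at h; omega
      rw [hg0] at h
      rw [hg0]
      simp [h, h00.ne]
    · have hg0 : g 0 = Fin.last m := by
        by_contra hne
        have := hf (Fin.lt_last_iff_ne_last.2 hne)
        have := (hvals (Fin.last m)).2
        omega
      rw [hg0] at h
      rw [hg0]
      simp only [Matrix.of_apply, h, h00.ne', if_false, if_true, zero_add, mul_one, Fin.val_last,
        Fin.val_zero, Nat.add_sub_cancel, Nat.sub_zero]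
      rw [← pow_add]
      exact Even.neg_one_pow ⟨m, rfl⟩

/-! ### Generating polynomials of matchings -/

/-- The exponent of the monomial `∏ b ∈ T, X b`. -/
def indicatorExp {β : Type} [DecidableEq β] (T : Finset β) : β →₀ ℕ :=
  Finsupp.indicator T fun _ _ => 1

theorem indicatorExp_apply {β : Type} [DecidableEq β] (T : Finset β) (b : β) :
    indicatorExp T b = if b ∈ T then 1 else 0 := by
  simp [indicatorExp, Finsupp.indicator_apply]

theorem indicatorExp_insert {β : Type} [DecidableEq β] {T : Finset β} {b : β} (hb : b ∉ T) :
    indicatorExp (insert b T) = indicatorExp T + Finsupp.single b 1 := by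
  ext x
  rw [Finsupp.add_apply, indicatorExp_apply, indicatorExp_apply, Finsupp.single_apply]
  by_cases hx : x = b
  · subst hx; simp [hb]
  · simp [hx, Ne.symm hx]

/-- The boundary measurement of a network whose white interior vertices contribute the factors of
`q`, each the sum of the variables of its black neighbours with their weights. The black vertices
are those in `T`, and the boundary vertex `k` is joined to the black vertex `bd k`. A matching that
leaves exactly the boundary vertices in `I` uncovered picks one term of each factor and the
variables `bd k`, `k ∉ I`, in such a way that every variable in `T` is picked once. -/
def matchingSum {β : Type} [DecidableEq β] {m : ℕ} (q : MvPolynomial β ℝ) (T : Finset β)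
    (bd : Fin m → β) (I : Finset (Fin m)) : ℝ :=
  MvPolynomial.coeff (indicatorExp T) (q * ∏ k ∈ Iᶜ, MvPolynomial.X (bd k))

section
open MvPolynomial

variable {β : Type} [DecidableEq β]

theorem coeff_insert_eq_zero {T : Finset β} {b : β} {f : MvPolynomial β ℝ}
    (hf : f ∈ supported ℝ ({b}ᶜ : Set β)) : coeff (indicatorExp (insert b T)) f = 0 := by
  by_contra h
  have hb : b ∉ f.vars := fun hb => by
    have := mem_supported.1 hf hb
    simp at this
  have := mem_support_notMem_vars_zero (mem_support_iff.2 h) hb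
  rw [indicatorExp_apply] at this
  simp at this

theorem coeff_insert_mul_X {T : Finset β} {b : β} (hb : b ∉ T) (f : MvPolynomial β ℝ) :
    coeff (indicatorExp (insert b T)) (f * X b) = coeff (indicatorExp T) f := by
  rw [indicatorExp_insert hb, coeff_mul_X]

theorem coeff_mul_X_of_notMem {T : Finset β} {b : β} (hb : b ∉ T) (f : MvPolynomial β ℝ) :
    coeff (indicatorExp T) (f * X b) = 0 := by
  rw [coeff_mul_X', if_neg]
  simp [indicatorExp_apply, hb]

theorem coeff_mul_X_mul_X (T : Finset β) (b : β) (f : MvPolynomial β ℝ) :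
    coeff (indicatorExp T) (f * X b * X b) = 0 := by
  rw [coeff_mul_X']
  split_ifs
  · rw [coeff_mul_X', if_neg]
    simp only [Finsupp.mem_support_iff, Finsupp.tsub_apply, Finsupp.single_eq_same,
      indicatorExp_apply]
    split_ifs <;> simp
  · rfl

/-- The boundary measurements after a new crossing. The new white vertex is joined to the black
vertex of the chamber at the boundary vertex `a`, which becomes an inner one, to that of the new
chamber `b`, which takes its place at the boundary, both with weight `α`, and to the black vertices
at the neighbouring boundary vertices `p` and `r`, with weight `γ`. -/
theorem matchingSum_addCrossing {m : ℕ} {q : MvPolynomial β ℝ} {T : Finset β} {bd : Fin m → β}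
    {b : β} (hb : b ∉ T) (hq : q ∈ supported ℝ ({b}ᶜ : Set β)) (hbd : ∀ k, bd k ≠ b)
    {p a r : Fin m} (hpa : p ≠ a) (hra : r ≠ a) (α γ : ℝ) (I : Finset (Fin m)) :
    matchingSum ((C α * X b + C α * X (bd a) + C γ * X (bd p) + C γ * X (bd r)) * q)
        (insert b T) (Function.update bd a b) I =
      α * matchingSum q T bd I +
        if a ∈ I then 0 else
          ((if p ∈ I then γ * matchingSum q T bd (insert a (I.erase p)) else 0) +
          if r ∈ I then γ * matchingSum q T bd (insert a (I.erase r)) else 0) := by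
  have hXs : ∀ k, (X (bd k) : MvPolynomial β ℝ) ∈ supported ℝ ({b}ᶜ : Set β) := fun k =>
    X_mem_supported.2 (by simpa using hbd k)
  by_cases ha : a ∈ I
  · have hprod : ∏ k ∈ Iᶜ, (X (Function.update bd a b k) : MvPolynomial β ℝ) =
        ∏ k ∈ Iᶜ, X (bd k) := by
      refine Finset.prod_congr rfl fun k hk => ?_
      rw [Function.update_of_ne]
      rintro rfl
      exact Finset.mem_compl.1 hk ha
    have hP : (∏ k ∈ Iᶜ, (X (bd k) : MvPolynomial β ℝ)) ∈ supported ℝ ({b}ᶜ : Set β) :=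
      Subalgebra.prod_mem _ fun k _ => hXs k
    have hzero : ∀ k, coeff (indicatorExp (insert b T))
        ((q * ∏ k ∈ Iᶜ, X (bd k)) * X (bd k)) = 0 := fun k =>
      coeff_insert_eq_zero (Subalgebra.mul_mem _ (Subalgebra.mul_mem _ hq hP) (hXs k))
    rw [if_pos ha, matchingSum, matchingSum, hprod]
    rw [show (C α * X b + C α * X (bd a) + C γ * X (bd p) + C γ * X (bd r)) * q *
        ∏ k ∈ Iᶜ, (X (bd k) : MvPolynomial β ℝ) =
        C α * ((q * ∏ k ∈ Iᶜ, X (bd k)) * X b) + C α * ((q * ∏ k ∈ Iᶜ, X (bd k)) * X (bd a)) +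
        C γ * ((q * ∏ k ∈ Iᶜ, X (bd k)) * X (bd p)) +
        C γ * ((q * ∏ k ∈ Iᶜ, X (bd k)) * X (bd r)) by ring]
    simp only [coeff_add, coeff_C_mul, hzero, coeff_insert_mul_X hb]
    ring
  · have hac : a ∈ Iᶜ := Finset.mem_compl.2 ha
    set R : MvPolynomial β ℝ := ∏ k ∈ Iᶜ.erase a, X (bd k) with hR
    have hprod : ∏ k ∈ Iᶜ, (X (Function.update bd a b k) : MvPolynomial β ℝ) = X b * R := by
      rw [← Finset.mul_prod_erase _ _ hac, Function.update_self]
      congr 1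
      refine Finset.prod_congr rfl fun k hk => ?_
      rw [Function.update_of_ne (Finset.ne_of_mem_erase hk)]
    have hprod' : ∏ k ∈ Iᶜ, (X (bd k) : MvPolynomial β ℝ) = X (bd a) * R :=
      (Finset.mul_prod_erase _ _ hac).symm
    have hnb : ∀ s : Fin m, s ≠ a → γ * coeff (indicatorExp T) (q * R * X (bd s)) =
        if s ∈ I then γ * matchingSum q T bd (insert a (I.erase s)) else 0 := by
      intro s hsa
      split_ifs with hs
      · have hc : (insert a (I.erase s))ᶜ = insert s (Iᶜ.erase a) := by
          ext x
          simp only [Finset.mem_compl, Finset.mem_insert, Finset.mem_erase]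
          by_cases hx : x = s
          · subst hx; simp [hsa]
          · simp [hx]
        rw [matchingSum, hc, Finset.prod_insert (by simp [hs]), ← hR, mul_assoc q R, mul_comm R]
      · have hs' : s ∈ Iᶜ.erase a := by simp [hs, hsa]
        rw [hR, ← Finset.prod_erase_mul _ _ hs', ← mul_assoc, coeff_mul_X_mul_X, mul_zero]
    rw [if_neg ha, matchingSum, matchingSum, hprod, hprod', ← hnb p hpa, ← hnb r hra]
    rw [show (C α * X b + C α * X (bd a) + C γ * X (bd p) + C γ * X (bd r)) * q * (X b * R) =
        (C α * (q * R * X b) + C α * (q * (X (bd a) * R)) +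
        C γ * (q * R * X (bd p)) + C γ * (q * R * X (bd r))) * X b by ring]
    rw [coeff_insert_mul_X hb]
    simp only [coeff_add, coeff_C_mul, coeff_mul_X_of_notMem hb]
    ring

/-- The sum of the variables of the neighbours `nb x`, with weights `w x`. -/
def neighbourPoly {δ : Type} [Fintype δ] (w : δ → ℝ) (nb : δ → β) : MvPolynomial β ℝ :=
  ∑ x, C (w x) * X (nb x)

end

/-! ### Boundary measurements as coefficients -/

theorem sum_single_eq_iff {Y B β : Type} [Fintype Y] [Fintype B] {ch : B → β}
    (hch : Function.Injective ch) (g : Y → B) :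
    ∑ y, Finsupp.single (ch (g y)) 1 = ∑ b, Finsupp.single (ch b) (1 : ℕ) ↔
      ∀ b, ∃! y, g y = b := by
  classical
  have h1 : ∀ {Z : Type} [Fintype Z] (h : Z → B), ∑ z, Finsupp.single (ch (h z)) (1 : ℕ) =
      Finsupp.mapDomain ch (∑ z, Finsupp.single (h z) 1) := by
    intro Z _ h
    simp [Finsupp.mapDomain_finsetSum, Finsupp.mapDomain_single]
  rw [h1 g, h1 (fun b : B => b), (Finsupp.mapDomain_injective hch).eq_iff, Finsupp.ext_iff]
  refine forall_congr' fun b => ?_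
  rw [Finsupp.finsetSum_apply, Finsupp.finsetSum_apply]
  simp only [Finsupp.single_apply, Finset.sum_ite_eq', Finset.mem_univ, if_true]
  rw [Finset.sum_boole, Nat.cast_id, Finset.card_eq_one]
  constructor
  · rintro ⟨y, hy⟩
    refine ⟨y, ?_, fun z hz => ?_⟩
    · have : y ∈ ({y} : Finset Y) := by simp
      rw [← hy] at this
      simpa using this
    · have : z ∈ Finset.univ.filter fun y => g y = b := by simpa using hz
      rw [hy] at this
      simpa using this
  · rintro ⟨y, hy, huniq⟩
    refine ⟨y, ?_⟩
    ext z
    simp only [Finset.mem_filter, Finset.mem_univ, true_and, Finset.mem_singleton]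
    exact ⟨huniq z, fun h => h ▸ hy⟩

namespace DiskNetwork

variable {n : ℕ} {V F E : Type} (D : DiskNetwork n V F E)

/-- The four black neighbours of the white vertex `w_e`. -/
def neighbour (e : E) : Bool ⊕ Bool → V ⊕ F :=
  Sum.map (D.vertexEnd e) (D.faceSide e)

/-- The weights of the four edges at the white vertex `w_e`. -/
def neighbourWeight (e : E) : Bool ⊕ Bool → ℝ :=
  Sum.elim (fun _ => D.cond e) (fun _ => 1)

/-- The edges of the matching given by a direction `d e` at each `w_e` and a set `I` of uncovered
boundary vertices: the edge from `w_e` in the direction `d e`, and for `k ∉ I` the edge at the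
boundary vertex `k`. -/
def matchingEdge (d : E → Bool ⊕ Bool) (I : Finset (Fin (2 * n))) :
    E ⊕ {k // k ∉ I} → (E × Bool) ⊕ (E × Bool) ⊕ Fin (2 * n) :=
  Sum.elim (fun e => Sum.elim (fun b => Sum.inl (e, b)) (fun b => Sum.inr (Sum.inl (e, b))) (d e))
    (fun k => Sum.inr (Sum.inr k.1))

theorem matchingEdge_injective (d : E → Bool ⊕ Bool) (I : Finset (Fin (2 * n))) :
    Function.Injective (matchingEdge d I) := by
  rintro (e | k) (e' | k') h
  · simp only [matchingEdge, Sum.elim_inl] at h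
    rcases hd : d e with b | b <;> rcases hd' : d e' with b' | b' <;>
      simp_all
  · simp only [matchingEdge, Sum.elim_inl, Sum.elim_inr] at h
    rcases hd : d e with b | b <;> simp_all
  · simp only [matchingEdge, Sum.elim_inl, Sum.elim_inr] at h
    rcases hd : d e' with b | b <;> simp_all
  · simpa [matchingEdge, Subtype.ext_iff] using h

/-- The black end of the edge `matchingEdge d I y`. -/
def matchedRegion (d : E → Bool ⊕ Bool) (I : Finset (Fin (2 * n))) : E ⊕ {k // k ∉ I} → V ⊕ F :=
  Sum.elim (fun e => D.neighbour e (d e)) (fun k => D.bdryRegion k.1)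

theorem blackEnd_matchingEdge (d : E → Bool ⊕ Bool) (I : Finset (Fin (2 * n)))
    (y : E ⊕ {k // k ∉ I}) :
    D.bipartite.blackEnd (matchingEdge d I y) = Sum.inr (Sum.inl (D.matchedRegion d I y)) := by
  rcases y with e | k
  · rcases hd : d e with b | b <;>
      simp [matchingEdge, matchedRegion, bipartite, neighbour, hd]
  · simp [matchingEdge, matchedRegion, bipartite]

theorem whiteEnd_matchingEdge (d : E → Bool ⊕ Bool) (I : Finset (Fin (2 * n)))
    (y : E ⊕ {k // k ∉ I}) :
    D.bipartite.whiteEnd (matchingEdge d I y) =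
      Sum.elim (fun e => Sum.inr (Sum.inr e)) (fun k => Sum.inl k.1) y := by
  rcases y with e | k
  · rcases hd : d e with b | b <;> simp [matchingEdge, bipartite, hd]
  · simp [matchingEdge, bipartite]

theorem incident_black_iff (x : (E × Bool) ⊕ (E × Bool) ⊕ Fin (2 * n)) (b : V ⊕ F) :
    D.bipartite.Incident x (Sum.inr (Sum.inl b)) ↔
      D.bipartite.blackEnd x = Sum.inr (Sum.inl b) := by
  rcases x with x | x | x <;> simp [BipartiteNetwork.Incident, bipartite]

theorem incident_white_iff (x : (E × Bool) ⊕ (E × Bool) ⊕ Fin (2 * n)) (e : E) :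
    D.bipartite.Incident x (Sum.inr (Sum.inr e)) ↔
      D.bipartite.whiteEnd x = Sum.inr (Sum.inr e) := by
  rcases x with x | x | x <;> simp [BipartiteNetwork.Incident, bipartite]

theorem incident_bdry_iff (x : (E × Bool) ⊕ (E × Bool) ⊕ Fin (2 * n)) (k : Fin (2 * n)) :
    D.bipartite.Incident x (Sum.inl k) ↔ x = Sum.inr (Sum.inr k) := by
  rcases x with x | x | x <;> simp [BipartiteNetwork.Incident, bipartite]

variable [Fintype E]

open Classical in
/-- The set of edges given by a direction at each `w_e` and the boundary vertices outside `I` is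
an almost perfect matching when every region is matched once. -/
theorem isAlmostPerfect_image_iff (d : E → Bool ⊕ Bool) (I : Finset (Fin (2 * n))) :
    (D.bipartite.IsAlmostPerfect (Finset.univ.image (matchingEdge d I)) ∧
      D.bipartite.HasBoundary (Finset.univ.image (matchingEdge d I)) I) ↔
      ∀ b, ∃! y, D.matchedRegion d I y = b := by
  have hmem : ∀ x, x ∈ Finset.univ.image (matchingEdge d I) ↔ ∃ y, matchingEdge d I y = x := by
    simp
  have hbdry : D.bipartite.HasBoundary (Finset.univ.image (matchingEdge d I)) I := by
    intro k
    refine ⟨fun h => absurd h (by simp [bipartite]), fun _ => ?_⟩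
    simp only [incident_bdry_iff, exists_eq_right, hmem]
    constructor
    · rintro hk ⟨y, hy⟩
      rcases y with e | k'
      · rcases hd : d e with b | b <;> simp [matchingEdge, hd] at hy
      · simp only [matchingEdge, Sum.elim_inr, Sum.inr.injEq] at hy
        exact k'.2 (hy ▸ hk)
    · intro h
      by_contra hk
      exact h ⟨Sum.inr ⟨k, hk⟩, rfl⟩
  have hex : ∀ p : (E × Bool) ⊕ (E × Bool) ⊕ Fin (2 * n) → Prop,
      (∃! x, x ∈ Finset.univ.image (matchingEdge d I) ∧ p x) ↔ ∃! y, p (matchingEdge d I y) := by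
    intro p
    constructor
    · rintro ⟨x, ⟨hx, hp⟩, hu⟩
      obtain ⟨y, rfl⟩ := (hmem x).1 hx
      exact ⟨y, hp, fun z hz => matchingEdge_injective d I (hu _ ⟨(hmem _).2 ⟨z, rfl⟩, hz⟩)⟩
    · rintro ⟨y, hy, hu⟩
      refine ⟨_, ⟨(hmem _).2 ⟨y, rfl⟩, hy⟩, ?_⟩
      rintro x ⟨hx, hp⟩
      obtain ⟨z, rfl⟩ := (hmem x).1 hx
      rw [hu z hp]
  constructor
  · rintro ⟨h, -⟩ b
    have := h (Sum.inl b)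
    simp only [incident_black_iff] at this
    rw [hex] at this
    simpa [blackEnd_matchingEdge] using this
  · intro h
    refine ⟨?_, hbdry⟩
    rintro (b | e)
    · simp only [incident_black_iff]
      rw [hex]
      simpa [blackEnd_matchingEdge] using h b
    · simp only [incident_white_iff]
      rw [hex]
      refine ⟨Sum.inl e, by simp [whiteEnd_matchingEdge], ?_⟩
      rintro (e' | k) h
      · simpa [whiteEnd_matchingEdge] using h
      · simp [whiteEnd_matchingEdge] at h

open Classical in
theorem exists_image_eq (P : Finset ((E × Bool) ⊕ (E × Bool) ⊕ Fin (2 * n)))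
    (I : Finset (Fin (2 * n))) (hP : D.bipartite.IsAlmostPerfect P)
    (hI : D.bipartite.HasBoundary P I) :
    ∃ d : E → Bool ⊕ Bool, Finset.univ.image (matchingEdge d I) = P := by
  have hd : ∀ e, ∃ x : Bool ⊕ Bool, ∀ z : (E × Bool) ⊕ (E × Bool) ⊕ Fin (2 * n),
      (z ∈ P ∧ D.bipartite.whiteEnd z = Sum.inr (Sum.inr e)) ↔
      z = Sum.elim (fun b => Sum.inl (e, b)) (fun b => Sum.inr (Sum.inl (e, b))) x := by
    intro e
    obtain ⟨z, ⟨hz, hze⟩, hu⟩ := hP (Sum.inr e)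
    rw [incident_white_iff] at hze
    have hu' : ∀ y, (y ∈ P ∧ D.bipartite.whiteEnd y = Sum.inr (Sum.inr e)) ↔ y = z := by
      intro y
      constructor
      · rintro ⟨h1, h2⟩
        exact hu y ⟨h1, (D.incident_white_iff y e).2 h2⟩
      · rintro rfl
        exact ⟨hz, hze⟩
    rcases z with ⟨e', b⟩ | ⟨e', b⟩ | k
    · obtain rfl : e' = e := by simpa [bipartite] using hze
      exact ⟨Sum.inl b, fun y => by simpa using hu' y⟩
    · obtain rfl : e' = e := by simpa [bipartite] using hze
      exact ⟨Sum.inr b, fun y => by simpa using hu' y⟩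
    · simp [bipartite] at hze
  choose d hd using hd
  have hk : ∀ k, Sum.inr (Sum.inr k) ∈ P ↔ k ∉ I := by
    intro k
    have := (hI k).2 (by simp [bipartite])
    simp only [incident_bdry_iff, exists_eq_right] at this
    rw [this, not_not]
  have hkey : ∀ z e, D.bipartite.whiteEnd z = Sum.inr (Sum.inr e) →
      (z ∈ P ↔ z = matchingEdge d I (Sum.inl e)) := by
    intro z e hz
    rw [matchingEdge, Sum.elim_inl, ← hd e z]
    exact ⟨fun h => ⟨h, hz⟩, fun h => h.1⟩
  refine ⟨d, ?_⟩
  ext z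
  simp only [Finset.mem_image, Finset.mem_univ, true_and]
  constructor
  · rintro ⟨e | k, rfl⟩
    · exact (hkey _ e (by simp [whiteEnd_matchingEdge])).2 rfl
    · exact (hk _).2 k.2
  · intro hz
    rcases z with ⟨e, b⟩ | ⟨e, b⟩ | k
    · exact ⟨Sum.inl e, ((hkey _ e (by simp [bipartite])).1 hz).symm⟩
    · exact ⟨Sum.inl e, ((hkey _ e (by simp [bipartite])).1 hz).symm⟩
    · exact ⟨Sum.inr ⟨k, (hk k).1 hz⟩, rfl⟩

open MvPolynomial in
/-- The boundary measurements of the bipartite network are coefficients of products of linear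
forms; the variables are named by an injective labelling `ch` of the regions. -/
theorem boundaryMeasurement_eq_coeff [Fintype V] [Fintype F] {β : Type} {ch : V ⊕ F → β}
    (hch : Function.Injective ch) (I : Finset (Fin (2 * n))) :
    D.bipartite.boundaryMeasurement I =
      coeff (∑ b, Finsupp.single (ch b) 1)
        ((∏ e, neighbourPoly (D.neighbourWeight e) fun x => ch (D.neighbour e x)) *
          ∏ k ∈ Iᶜ, X (ch (D.bdryRegion k))) := by
  classical
  have hterm : ∀ d : E → Bool ⊕ Bool,
      coeff (∑ b, Finsupp.single (ch b) 1)
        ((∏ e, C (D.neighbourWeight e (d e)) * X (ch (D.neighbour e (d e)))) *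
          ∏ k ∈ Iᶜ, (X (ch (D.bdryRegion k)) : MvPolynomial β ℝ)) =
      if ∀ b, ∃! y, D.matchedRegion d I y = b then ∏ e, D.neighbourWeight e (d e) else 0 := by
    intro d
    have hmon : ∀ {Z : Type} (s : Finset Z) (h : Z → β), ∏ z ∈ s, (X (h z) : MvPolynomial β ℝ) =
        monomial (∑ z ∈ s, Finsupp.single (h z) 1) 1 := by
      intro Z s h
      rw [monomial_sum_one]
      rfl
    have hexp : (∑ e, Finsupp.single (ch (D.neighbour e (d e))) 1) +
        ∑ k ∈ Iᶜ, Finsupp.single (ch (D.bdryRegion k)) (1 : ℕ) =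
        ∑ y, Finsupp.single (ch (D.matchedRegion d I y)) 1 := by
      rw [Fintype.sum_sum_type]
      congr 1
      exact Finset.sum_subtype _ (by simp) _
    rw [Finset.prod_mul_distrib, ← map_prod, hmon, hmon, mul_assoc, monomial_mul, hexp,
      coeff_C_mul, coeff_monomial, one_mul]
    have hiff := sum_single_eq_iff hch (D.matchedRegion d I)
    by_cases h : ∀ b, ∃! y, D.matchedRegion d I y = b
    · rw [if_pos (hiff.2 h), if_pos h, mul_one]
    · rw [if_neg (hiff.not.2 h), if_neg h, mul_zero]
  rw [BipartiteNetwork.boundaryMeasurement]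
  simp only [neighbourPoly, Finset.prod_univ_sum, Finset.sum_mul, coeff_sum]
  rw [Fintype.piFinset_univ]
  symm
  refine Finset.sum_of_injOn (fun d => Finset.univ.image (matchingEdge d I)) ?_ (by simp) ?_ ?_
  · intro d _ d' _ h
    funext e
    have h1 : matchingEdge d I (Sum.inl e) ∈ Finset.univ.image (matchingEdge d' I) := by
      have h' : Finset.univ.image (matchingEdge d I) = Finset.univ.image (matchingEdge d' I) := h
      rw [← h']
      exact Finset.mem_image_of_mem _ (Finset.mem_univ _)
    obtain ⟨y, -, hy⟩ := Finset.mem_image.1 h1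
    have h2 := congrArg D.bipartite.whiteEnd hy
    rw [whiteEnd_matchingEdge, whiteEnd_matchingEdge] at h2
    rcases y with e' | k
    · obtain rfl : e' = e := by simpa using h2
      simp only [matchingEdge, Sum.elim_inl] at hy
      rcases hd : d e' with b | b <;> rcases hd' : d' e' with b' | b' <;> simp_all
    · simp at h2
  · intro P _ hP
    rw [if_neg]
    rintro ⟨h1, h2⟩
    obtain ⟨d, rfl⟩ := D.exists_image_eq P I h1 h2
    exact hP ⟨d, by simp, rfl⟩
  · intro d _
    rw [hterm d]
    refine if_congr (D.isAlmostPerfect_image_iff d I).symm ?_ rfl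
    rw [Finset.prod_image (matchingEdge_injective d I).injOn, Fintype.prod_sum_type]
    have h1 : ∀ k : {k // k ∉ I}, D.bipartite.weight (matchingEdge d I (Sum.inr k)) = 1 :=
      fun k => by simp [matchingEdge, bipartite]
    simp only [h1, Finset.prod_const_one, mul_one]
    refine Finset.prod_congr rfl fun e _ => ?_
    rcases hd : d e with b | b <;> simp [matchingEdge, bipartite, neighbourWeight, hd]

end DiskNetwork

/-! ### Partially built standard networks -/

/-- The label of the chamber `(i, j)`; all the chambers `(i, i)` have the label `(0, 0)`. -/
def chamber (i j : ℕ) : ℕ × ℕ := if i < j then (i, j) else (0, 0)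

/-- The label of a vertex or face of the standard graph. -/
def regionLabel {n : ℕ} : StdVertex n ⊕ StdFace n → ℕ × ℕ :=
  Sum.elim Subtype.val Subtype.val

theorem regionLabel_injective {n : ℕ} : Function.Injective (regionLabel (n := n)) := by
  have key : ∀ (v : StdVertex n) (f : StdFace n), v.1 ≠ f.1 := by
    intro v f h
    have h1 := v.2.2
    rw [h] at h1
    exact Nat.not_even_iff_odd.2 f.2.2 h1
  rintro (v | f) (v' | f') h
  · exact congrArg Sum.inl (Subtype.ext h)
  · exact absurd h (key v f')
  · exact absurd h.symm (key v' f)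
  · exact congrArg Sum.inr (Subtype.ext h)

theorem regionLabel_stdVertex {n i j : ℕ} (hij : i ≤ j) (hj : j ≤ n) (he : Even (i + j)) :
    regionLabel (n := n) (Sum.inl (stdVertex i j hij hj he)) = chamber i j := by
  unfold regionLabel stdVertex chamber
  split_ifs <;> rfl

theorem regionLabel_stdFace {n i j : ℕ} (hij : i ≤ j) (hj : j ≤ n) (ho : Odd (i + j)) :
    regionLabel (n := n) (Sum.inr (stdFace i j hij hj ho)) = chamber i j := by
  have : i < j := by rcases ho with ⟨r, hr⟩; omega
  unfold regionLabel stdFace chamber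
  rw [if_pos this]
  rfl

variable {n : ℕ}

/-- The weight of the two edges from `w_e` to the chambers on the diagonal through the crossing. -/
def diagWeight (c : StdEdge n → ℝ) (e : StdEdge n) : ℝ :=
  if Even (e.1.1.val + e.1.2.val) then c e else 1

/-- The weight of the two edges from `w_e` to the chambers on the antidiagonal. -/
def antidiagWeight (c : StdEdge n → ℝ) (e : StdEdge n) : ℝ :=
  if Even (e.1.1.val + e.1.2.val) then 1 else c e

/-- The sum of the variables of the four chambers at a crossing, with their weights. -/
def crossingPoly (c : StdEdge n → ℝ) (e : StdEdge n) : MvPolynomial (ℕ × ℕ) ℝ :=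
  neighbourPoly ((stdNetwork n c).neighbourWeight e)
    fun x => regionLabel ((stdNetwork n c).neighbour e x)

open MvPolynomial in
theorem crossingPoly_eq (c : StdEdge n → ℝ) (e : StdEdge n) :
    crossingPoly c e =
      C (diagWeight c e) * X (chamber e.1.1 e.1.2) +
      C (diagWeight c e) * X (chamber (e.1.1 + 1) (e.1.2 + 1)) +
      C (antidiagWeight c e) * X (chamber (e.1.1 + 1) e.1.2) +
      C (antidiagWeight c e) * X (chamber e.1.1 (e.1.2 + 1)) := by
  by_cases h : Even (e.1.1.val + e.1.2.val)
  · simp [crossingPoly, neighbourPoly, DiskNetwork.neighbourWeight, DiskNetwork.neighbour,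
      stdNetwork, h, diagWeight, antidiagWeight, regionLabel_stdVertex, regionLabel_stdFace]
    ring
  · simp [crossingPoly, neighbourPoly, DiskNetwork.neighbourWeight, DiskNetwork.neighbour,
      stdNetwork, h, diagWeight, antidiagWeight, regionLabel_stdVertex, regionLabel_stdFace]
    ring

/-- The crossings `(i', j')` that come up to the crossing `(i, j)`: those with `i' > i`, or `i' = i`
and `j' ≥ j`. -/
def builtEdges (n i j : ℕ) : Finset (StdEdge n) :=
  Finset.univ.filter fun e => i < e.1.1.val ∨ (e.1.1.val = i ∧ j ≤ e.1.2.val)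

/-- The chambers of the network that has the crossings `builtEdges n i j`: those on its right
side, which exist without any crossing, and the ones above the crossings. -/
def builtChambers (n i j : ℕ) : Finset (ℕ × ℕ) :=
  (Finset.range (n + 1) ×ˢ Finset.range (n + 1)).filter fun p =>
    p = (0, 0) ∨ (p.1 < p.2 ∧ (p.2 = n ∨ i < p.1 ∨ (p.1 = i ∧ j ≤ p.2)))

/-- The chamber at the boundary vertex `k` (counted from `0`) in the network that has the
crossings `builtEdges n i j`. -/
def builtBdry (n i j : ℕ) (k : Fin (2 * n)) : ℕ × ℕ :=
  if k.val + i < j then chamber (i + 1) (i + 1 + k.val)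
  else if k.val + i ≤ n then chamber i (i + k.val)
  else if k.val ≤ n then (n - k.val, n)
  else (k.val - n, n)

/-- The boundary measurements of the network that has the crossings `builtEdges n i j`. -/
def builtMeasurement (c : StdEdge n → ℝ) (i j : ℕ) (I : Finset (Fin (2 * n))) : ℝ :=
  matchingSum (∏ e ∈ builtEdges n i j, crossingPoly c e) (builtChambers n i j) (builtBdry n i j) I

theorem builtBdry_eq_update {i j : Fin n} (hij : i < j) :
    builtBdry n i j =
      Function.update (builtBdry n i (j + 1)) ⟨j.val - i.val, by omega⟩ (i.val, j.val) := by
  rw [Fin.lt_def] at hij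
  funext k
  by_cases hk : k = ⟨j.val - i.val, by omega⟩
  · subst hk
    have h2 : i.val + (j.val - i.val) = j.val := by omega
    simp only [Function.update_self, builtBdry, h2]
    rw [if_neg (by omega), if_pos (by omega), chamber, if_pos hij]
  · rw [Function.update_of_ne hk]
    have hk' : k.val ≠ j.val - i.val := fun h => hk (Fin.ext h)
    unfold builtBdry
    by_cases h1 : k.val + i.val < j.val
    · rw [if_pos h1, if_pos (by omega)]
    · rw [if_neg h1, if_neg (show ¬ (k.val + i.val < j.val + 1) by omega)]

theorem builtChambers_eq_insert {i j : Fin n} (hij : i < j) :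
    builtChambers n i j = insert (i.val, j.val) (builtChambers n i (j + 1)) := by
  rw [Fin.lt_def] at hij
  ext ⟨x, y⟩
  simp only [builtChambers, Finset.mem_filter, Finset.mem_product, Finset.mem_range,
    Prod.mk.injEq, Finset.mem_insert]
  omega

theorem notMem_builtChambers {i j : Fin n} (hij : i < j) :
    (i.val, j.val) ∉ builtChambers n i (j + 1) := by
  rw [Fin.lt_def] at hij
  simp only [builtChambers, Finset.mem_filter, Finset.mem_product, Finset.mem_range,
    Prod.mk.injEq]
  omega

theorem builtEdges_eq_insert {i j : Fin n} (hij : i < j) :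
    builtEdges n i j = insert ⟨(i, j), hij⟩ (builtEdges n i (j + 1)) := by
  ext ⟨⟨x, y⟩, hxy⟩
  simp only [builtEdges, Finset.mem_filter, Finset.mem_univ, true_and, Finset.mem_insert,
    Subtype.mk.injEq, Prod.mk.injEq, Fin.ext_iff]
  omega

theorem notMem_builtEdges {i j : Fin n} (hij : i < j) :
    (⟨(i, j), hij⟩ : StdEdge n) ∉ builtEdges n i (j + 1) := by
  simp [builtEdges]

theorem builtBdry_ne {i j : Fin n} (hij : i < j) (k : Fin (2 * n)) :
    builtBdry n i (j + 1) k ≠ (i.val, j.val) := by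
  rw [Fin.lt_def] at hij
  unfold builtBdry chamber
  split_ifs <;> simp only [ne_eq, Prod.mk.injEq] <;> omega

open MvPolynomial in
theorem crossingPoly_mem_supported (c : StdEdge n → ℝ) {i j : Fin n} (hij : i < j) {e : StdEdge n}
    (he : e ∈ builtEdges n i (j + 1)) :
    crossingPoly c e ∈ supported ℝ ({(i.val, j.val)}ᶜ : Set (ℕ × ℕ)) := by
  rw [Fin.lt_def] at hij
  simp only [builtEdges, Finset.mem_filter, Finset.mem_univ, true_and] at he
  have h0 := e.2
  rw [Fin.lt_def] at h0
  have key : ∀ (w : ℝ) (x y : ℕ), chamber x y ≠ (i.val, j.val) →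
      C w * X (chamber x y) ∈ supported ℝ ({(i.val, j.val)}ᶜ : Set (ℕ × ℕ)) := by
    intro w x y h
    refine Subalgebra.mul_mem _ ((supported ℝ _).algebraMap_mem w) (X_mem_supported.2 ?_)
    simpa using h
  rw [crossingPoly_eq]
  refine Subalgebra.add_mem _ (Subalgebra.add_mem _ (Subalgebra.add_mem _ ?_ ?_) ?_) ?_ <;>
  · refine key _ _ _ ?_
    unfold chamber
    split_ifs <;> simp only [ne_eq, Prod.mk.injEq] <;> omega

/-- The effect of the crossing `(i, j)` on the boundary measurements. -/
theorem builtMeasurement_step (c : StdEdge n → ℝ) {i j : Fin n} (hij : i < j) {p a r : Fin (2 * n)}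
    (hp : p.val + 1 = j.val - i.val) (ha : a.val = j.val - i.val) (hr : r.val = j.val - i.val + 1)
    (I : Finset (Fin (2 * n))) :
    builtMeasurement c i j I =
      diagWeight c ⟨(i, j), hij⟩ * builtMeasurement c i (j + 1) I +
        if a ∈ I then 0 else
          ((if p ∈ I then
              antidiagWeight c ⟨(i, j), hij⟩ * builtMeasurement c i (j + 1) (insert a (I.erase p))
            else 0) +
          if r ∈ I then
            antidiagWeight c ⟨(i, j), hij⟩ * builtMeasurement c i (j + 1) (insert a (I.erase r))
          else 0) := by
  have hij' : i.val < j.val := hij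
  have hpa : p ≠ a := by rintro rfl; omega
  have hra : r ≠ a := by rintro rfl; omega
  have haeq : (⟨j.val - i.val, by omega⟩ : Fin (2 * n)) = a := Fin.ext ha.symm
  have hb : chamber i j = (i.val, j.val) := if_pos hij'
  have hbda : builtBdry n i (j + 1) a = chamber (i + 1) (j + 1) := by
    unfold builtBdry
    rw [if_pos (by omega)]
    congr 1
    omega
  have hbdp : builtBdry n i (j + 1) p = chamber (i + 1) j := by
    unfold builtBdry
    rw [if_pos (by omega)]
    congr 1
    omega
  have hbdr : builtBdry n i (j + 1) r = chamber i (j + 1) := by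
    unfold builtBdry
    rw [if_neg (by omega), if_pos (by omega)]
    congr 1
    omega
  have hstep := matchingSum_addCrossing (q := ∏ e ∈ builtEdges n i (j + 1), crossingPoly c e)
    (notMem_builtChambers hij)
    (Subalgebra.prod_mem _ fun e he => crossingPoly_mem_supported c hij he)
    (builtBdry_ne hij) hpa hra (diagWeight c ⟨(i, j), hij⟩) (antidiagWeight c ⟨(i, j), hij⟩) I
  rw [builtMeasurement, builtBdry_eq_update hij, builtChambers_eq_insert hij,
    builtEdges_eq_insert hij, Finset.prod_insert (notMem_builtEdges hij), crossingPoly_eq, haeq]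
  rw [hbda, hbdp, hbdr] at hstep
  simp only [hb]
  exact hstep

/-- There is no crossing `(i, j)` with `j ≤ i`. -/
theorem builtMeasurement_of_le (c : StdEdge n → ℝ) {i j : ℕ} (hji : j ≤ i) (hi : i ≤ n) :
    builtMeasurement c i j = builtMeasurement c i (j + 1) := by
  have h1 : builtEdges n i j = builtEdges n i (j + 1) := by
    ext ⟨⟨x, y⟩, hxy⟩
    rw [Fin.lt_def] at hxy
    simp only [builtEdges, Finset.mem_filter, Finset.mem_univ, true_and] at *
    omega
  have h2 : builtChambers n i j = builtChambers n i (j + 1) := by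
    ext ⟨x, y⟩
    simp only [builtChambers, Finset.mem_filter, Finset.mem_product, Finset.mem_range,
      Prod.mk.injEq]
    omega
  have h3 : builtBdry n i j = builtBdry n i (j + 1) := by
    funext k
    unfold builtBdry chamber
    split_ifs <;> simp only [Prod.mk.injEq] <;> omega
  funext I
  rw [builtMeasurement, builtMeasurement, h1, h2, h3]

/-- A row without crossings is the end of the row below. -/
theorem builtMeasurement_row (c : StdEdge n → ℝ) {i : ℕ} (hi : i < n) :
    builtMeasurement c i n = builtMeasurement c (i + 1) 0 := by
  have h1 : builtEdges n i n = builtEdges n (i + 1) 0 := by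
    ext ⟨⟨x, y⟩, hxy⟩
    simp only [builtEdges, Finset.mem_filter, Finset.mem_univ, true_and]
    omega
  have h2 : builtChambers n i n = builtChambers n (i + 1) 0 := by
    ext ⟨x, y⟩
    simp only [builtChambers, Finset.mem_filter, Finset.mem_product, Finset.mem_range,
      Prod.mk.injEq]
    omega
  have h3 : builtBdry n i n = builtBdry n (i + 1) 0 := by
    funext k
    unfold builtBdry chamber
    split_ifs <;> simp only [Prod.mk.injEq] <;> omega
  funext I
  rw [builtMeasurement, builtMeasurement, h1, h2, h3]

/-- With all its crossings the network is the standard network. -/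
theorem builtMeasurement_zero_zero (hn : 1 ≤ n) (c : StdEdge n → ℝ) :
    builtMeasurement c 0 0 = (stdNetwork n c).bipartite.boundaryMeasurement := by
  have : Finite (StdVertex n) := by
    refine Finite.of_injective
      (fun v : StdVertex n => ((⟨v.1.1, ?_⟩, ⟨v.1.2, ?_⟩) : Fin (n + 1) × Fin (n + 1))) ?_
    · obtain ⟨⟨x, y⟩, h, -⟩ := v
      simp only [Prod.mk.injEq] at h ⊢
      omega
    · obtain ⟨⟨x, y⟩, h, -⟩ := v
      simp only [Prod.mk.injEq] at h ⊢
      omega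
    · intro v w h
      simp only [Prod.mk.injEq, Fin.mk.injEq] at h
      exact Subtype.ext (Prod.ext h.1 h.2)
  have : Finite (StdFace n) := by
    refine Finite.of_injective
      (fun v : StdFace n => ((⟨v.1.1, ?_⟩, ⟨v.1.2, ?_⟩) : Fin (n + 1) × Fin (n + 1))) ?_
    · obtain ⟨⟨x, y⟩, ⟨h, h'⟩, -⟩ := v
      simp only at h h' ⊢
      omega
    · obtain ⟨⟨x, y⟩, ⟨h, h'⟩, -⟩ := v
      simp only at h h' ⊢
      omega
    · intro v w h
      simp only [Prod.mk.injEq, Fin.mk.injEq] at h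
      exact Subtype.ext (Prod.ext h.1 h.2)
  have := Fintype.ofFinite (StdVertex n)
  have := Fintype.ofFinite (StdFace n)
  funext I
  rw [DiskNetwork.boundaryMeasurement_eq_coeff _ regionLabel_injective, builtMeasurement,
    matchingSum]
  have h1 : builtEdges n 0 0 = Finset.univ := by
    ext e
    simp only [builtEdges, Finset.mem_filter, Finset.mem_univ, true_and, iff_true]
    omega
  have h2 : indicatorExp (builtChambers n 0 0) =
      ∑ b : StdVertex n ⊕ StdFace n, Finsupp.single (regionLabel b) 1 := by
    have himg : builtChambers n 0 0 = Finset.univ.image (regionLabel (n := n)) := by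
      ext ⟨x, y⟩
      simp only [builtChambers, Finset.mem_filter, Finset.mem_product, Finset.mem_range,
        Prod.mk.injEq, Finset.mem_image, Finset.mem_univ, true_and]
      constructor
      · intro h
        by_cases hp : Even (x + y)
        · exact ⟨Sum.inl ⟨(x, y), by simp only [Prod.mk.injEq]; omega, hp⟩, rfl⟩
        · have hp' := Nat.not_even_iff_odd.1 hp
          refine ⟨Sum.inr ⟨(x, y), ?_, hp'⟩, rfl⟩
          rw [Nat.odd_iff] at hp'
          simp only
          omega
      · rintro ⟨⟨v, hv⟩ | ⟨v, hv⟩, hb⟩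
        · obtain rfl : v = (x, y) := hb
          simp only [Prod.mk.injEq] at hv
          omega
        · obtain rfl : v = (x, y) := hb
          simp only at hv
          omega
    ext b
    rw [indicatorExp_apply, himg, ← Finset.sum_image
      (f := fun b => Finsupp.single b 1) regionLabel_injective.injOn, Finsupp.finsetSum_apply]
    simp [Finsupp.single_apply]
  have h3 : ∀ k, builtBdry n 0 0 k = regionLabel ((stdNetwork n c).bdryRegion k) := by
    intro k
    unfold DiskNetwork.bdryRegion
    split_ifs with hk
    · simp only [stdNetwork, regionLabel_stdVertex]
      unfold builtBdry chamber
      split_ifs <;> simp only [Prod.mk.injEq] <;> omega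
    · simp only [stdNetwork, regionLabel_stdFace]
      unfold builtBdry chamber
      split_ifs <;> simp only [Prod.mk.injEq] <;> omega
  rw [h1, h2]
  simp only [h3]
  rfl

/-! ### Differences along the boundary and the action of a crossing -/

/-- The place before `k` on the circle. -/
def prevPlace (k : Fin (2 * n)) : Fin (2 * n) :=
  ⟨(k.val + 2 * n - 1) % (2 * n), Nat.mod_lt _ (Nat.zero_lt_of_lt k.2)⟩

theorem prevPlace_of_succ {p a : Fin (2 * n)} (h : p.val + 1 = a.val) : prevPlace a = p := by
  refine Fin.ext ?_
  have : a.val + 2 * n - 1 = p.val + 2 * n := by omega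
  simp only [prevPlace, this, Nat.add_mod_right]
  exact Nat.mod_eq_of_lt p.2

theorem prevPlace_of_zero {p a : Fin (2 * n)} (h : a.val = 0) (hp : p.val + 1 = 2 * n) :
    prevPlace a = p := by
  refine Fin.ext ?_
  have : a.val + 2 * n - 1 = p.val := by omega
  simp only [prevPlace, this]
  exact Nat.mod_eq_of_lt p.2

/-- The differences `v (k - 1) - v k` of neighbouring values, with the indices modulo `2n`. -/
def bdryDiff (n : ℕ) : (Fin (2 * n) → ℝ) →ₗ[ℝ] (Fin (2 * n) → ℝ) where
  toFun v k := v (prevPlace k) - v k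
  map_add' v w := by funext k; simp; ring
  map_smul' s v := by funext k; simp; ring

theorem bdryDiff_apply (v : Fin (2 * n) → ℝ) (k : Fin (2 * n)) :
    bdryDiff n v k = v (prevPlace k) - v k := rfl

/-- The transvection `x ↦ x + t x_a (e_{a - 1} - e_{a + 1})`, which describes the effect on the
boundary differences of a crossing between the places `a - 1` and `a`. -/
def crossingMap (a : Fin (2 * n)) (t : ℝ) : (Fin (2 * n) → ℝ) →ₗ[ℝ] (Fin (2 * n) → ℝ) where
  toFun x l := x l + ((if l.val + 1 = a.val then t * x a else 0) -
    if l.val = a.val + 1 then t * x a else 0)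
  map_add' v w := by
    funext l
    simp only [Pi.add_apply]
    split_ifs <;> ring
  map_smul' s v := by
    funext l
    simp only [Pi.smul_apply, smul_eq_mul, RingHom.id_apply]
    split_ifs <;> ring

theorem crossingMap_apply (a : Fin (2 * n)) (t : ℝ) (x : Fin (2 * n) → ℝ) (l : Fin (2 * n)) :
    crossingMap a t x l = x l + ((if l.val + 1 = a.val then t * x a else 0) -
      if l.val = a.val + 1 then t * x a else 0) := rfl

theorem crossingMap_injective (a : Fin (2 * n)) (t : ℝ) : Function.Injective (crossingMap a t) := by
  refine (injective_iff_map_eq_zero _).2 fun x hx => ?_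
  have ha : x a = 0 := by
    have := congrFun hx a
    simpa [crossingMap_apply] using this
  funext l
  have := congrFun hx l
  simpa [crossingMap_apply, ha] using this

theorem bdryDiff_eq_crossingMap {v v' : Fin (2 * n) → ℝ} {p a : Fin (2 * n)}
    (hp : p.val + 1 = a.val) (ha : a.val + 1 < 2 * n) {t : ℝ}
    (hv' : ∀ k, v' k = v k - if k = p ∨ k = a then t * (v p - v a) else 0) :
    bdryDiff n v' = crossingMap a t (bdryDiff n v) := by
  funext l
  have hda : bdryDiff n v a = v p - v a := by rw [bdryDiff_apply, prevPlace_of_succ hp]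
  rw [crossingMap_apply, hda]
  have hpa : p ≠ a := by rintro rfl; omega
  obtain ⟨q, hq⟩ : ∃ q : Fin (2 * n), (q.val + 1 = l.val) ∨ (l.val = 0 ∧ q.val + 1 = 2 * n) := by
    by_cases hl : l.val = 0
    · exact ⟨⟨2 * n - 1, by omega⟩, Or.inr ⟨hl, by simp only; omega⟩⟩
    · exact ⟨⟨l.val - 1, by omega⟩, Or.inl (by simp only; omega)⟩
  have hd : ∀ u, bdryDiff n u l = u q - u l := fun u => by
    rcases hq with hq | ⟨h0, hq⟩
    · rw [bdryDiff_apply, prevPlace_of_succ hq]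
    · rw [bdryDiff_apply, prevPlace_of_zero h0 hq]
  rw [hd, hd, hv' q, hv' l]
  by_cases h1 : l = p
  · subst h1
    have : ¬ (q = l ∨ q = a) := by
      rintro (rfl | rfl) <;> omega
    rw [if_neg this, if_pos (Or.inl rfl), if_pos hp, if_neg (by omega)]
    ring
  · by_cases h2 : l = a
    · subst h2
      have : q = p := Fin.ext (by omega)
      rw [if_pos (Or.inl this), if_pos (Or.inr rfl), if_neg (by omega), if_neg (by omega)]
      ring
    · have h1' : ¬ (l.val + 1 = a.val) := fun h => h1 (Fin.ext (by omega))
      rw [if_neg (show ¬ (l = p ∨ l = a) by tauto), if_neg h1']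
      by_cases h3 : l.val = a.val + 1
      · have : q = a := Fin.ext (by omega)
        rw [if_pos (Or.inr this), if_pos h3]
        ring
      · have : ¬ (q = p ∨ q = a) := by
          rintro (rfl | rfl)
          · exact h2 (Fin.ext (by omega))
          · omega
        rw [if_neg this, if_neg h3]
        ring

/-! ### The symplectic form in terms of the differences -/

/-- The form `λ_{2n}` in the coordinates given by the boundary differences, that is, with the
columns in the order of the boundary vertices. -/
def diffForm (n : ℕ) : Matrix (Fin (2 * n)) (Fin (2 * n)) ℝ :=
  Matrix.of fun p q =>
    if p.val % 2 = 1 ∧ q.val % 2 = 0 ∧ q.val < p.val then 1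
    else if p.val % 2 = 0 ∧ q.val % 2 = 1 ∧ p.val < q.val then -1
    else 0

/-- The indicator function of the indices with remainder `r` modulo `2`. -/
def parityVec (n r : ℕ) : Fin (2 * n) → ℝ := fun k => if k.val % 2 = r then 1 else 0

theorem crossingMap_eq_add {p a r : Fin (2 * n)} (hp : p.val + 1 = a.val)
    (hr : r.val = a.val + 1) (t : ℝ) (x : Fin (2 * n) → ℝ) :
    crossingMap a t x = x + (t * x a) • (Pi.single p 1 - Pi.single r 1) := by
  funext l
  have h1 : (l.val + 1 = a.val) ↔ l = p := by rw [Fin.ext_iff]; omega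
  have h2 : (l.val = a.val + 1) ↔ l = r := by rw [Fin.ext_iff]; omega
  simp only [crossingMap_apply, h1, h2, Pi.add_apply, Pi.smul_apply, Pi.sub_apply, Pi.single_apply,
    smul_eq_mul]
  split_ifs <;> ring

theorem diffForm_mulVec_single_sub_single {p a r : Fin (2 * n)} (hp : p.val + 1 = a.val)
    (hr : r.val = a.val + 1) :
    (diffForm n).mulVec (Pi.single p 1 - Pi.single r 1) = Pi.single a 1 := by
  funext l
  rw [Matrix.mulVec_sub, Matrix.mulVec_single_one, Matrix.mulVec_single_one]
  have h : (l = a) ↔ (l.val = a.val) := Fin.ext_iff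
  simp only [Pi.sub_apply, Matrix.col_apply, Pi.single_apply, h, diffForm, Matrix.of_apply]
  split_ifs <;> first | omega | norm_num

theorem diffForm_crossingMap {p a r : Fin (2 * n)} (hp : p.val + 1 = a.val)
    (hr : r.val = a.val + 1) (t : ℝ) (x y : Fin (2 * n) → ℝ) :
    crossingMap a t x ⬝ᵥ (diffForm n).mulVec (crossingMap a t y) =
      x ⬝ᵥ (diffForm n).mulVec y := by
  have hpa : p ≠ a := by rintro rfl; omega
  have hra : r ≠ a := by rintro rfl; omega
  set u : Fin (2 * n) → ℝ := Pi.single p 1 - Pi.single r 1 with hu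
  have hrow : Matrix.vecMul u (diffForm n) = -Pi.single a 1 := by
    funext l
    rw [hu, Matrix.sub_vecMul, Matrix.single_one_vecMul, Matrix.single_one_vecMul]
    have h : (l = a) ↔ (l.val = a.val) := Fin.ext_iff
    simp only [Pi.sub_apply, Matrix.row_apply, Pi.neg_apply, Pi.single_apply, h, diffForm,
      Matrix.of_apply]
    split_ifs <;> first | omega | norm_num
  have hcol : (diffForm n).mulVec u = Pi.single a 1 := diffForm_mulVec_single_sub_single hp hr
  have hua : u ⬝ᵥ Pi.single a 1 = 0 := by
    rw [dotProduct_single_one, hu]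
    simp [hpa.symm, hra.symm]
  have h1 : ∀ z, u ⬝ᵥ (diffForm n).mulVec z = -z a := by
    intro z
    rw [Matrix.dotProduct_mulVec, hrow]
    simp
  rw [crossingMap_eq_add hp hr, crossingMap_eq_add hp hr, ← hu, Matrix.mulVec_add,
    Matrix.mulVec_smul, hcol, add_dotProduct, dotProduct_add, dotProduct_add, smul_dotProduct,
    smul_dotProduct, dotProduct_smul, dotProduct_smul, hua, h1, dotProduct_single_one]
  simp only [smul_eq_mul]
  ring

theorem crossingMap_dotProduct_parityVec {p a r : Fin (2 * n)} (hp : p.val + 1 = a.val)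
    (hr : r.val = a.val + 1) (t : ℝ) (x : Fin (2 * n) → ℝ) (s : ℕ) :
    crossingMap a t x ⬝ᵥ parityVec n s = x ⬝ᵥ parityVec n s := by
  have h : p.val % 2 = r.val % 2 := by omega
  rw [crossingMap_eq_add hp hr, add_dotProduct, smul_dotProduct, sub_dotProduct,
    single_one_dotProduct, single_one_dotProduct]
  simp [parityVec, h]

/-! ### The effect of a crossing on the maximal minors -/

/-- The sign `(-1)^⌊k / 2⌋`. -/
def bdrySign (k : ℕ) : ℝ := (-1) ^ (k / 2)

theorem bdrySign_mul_self (k : ℕ) : bdrySign k * bdrySign k = 1 := by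
  rw [bdrySign, ← pow_add]
  exact Even.neg_one_pow ⟨_, rfl⟩

theorem bdrySign_ne_zero (k : ℕ) : bdrySign k ≠ 0 := by
  unfold bdrySign
  positivity

theorem bdrySign_succ (k : ℕ) :
    bdrySign (k + 1) = if k % 2 = 0 then bdrySign k else -bdrySign k := by
  unfold bdrySign
  split_ifs with h
  · congr 1
    omega
  · rw [show (k + 1) / 2 = k / 2 + 1 by omega, pow_succ]
    ring

/-- The matrix `B` with its columns multiplied by the signs `bdrySign`. -/
def signColumns {k : ℕ} (B : Matrix (Fin k) (Fin (2 * n)) ℝ) : Matrix (Fin k) (Fin (2 * n)) ℝ :=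
  Matrix.of fun r l => bdrySign l * B r l

theorem maxMinor_crossingMap (c : StdEdge n → ℝ) (hc : ∀ e, c e ≠ 0) {i j : Fin n} (hij : i < j)
    {a : Fin (2 * n)} (ha : a.val = j.val - i.val) {k : ℕ} {B : Matrix (Fin k) (Fin (2 * n)) ℝ}
    {s : ℝ}
    (hB : ∀ I : Finset (Fin (2 * n)), I.card = k →
      maxMinor (signColumns B) I = s * builtMeasurement c i (j + 1) I)
    (I : Finset (Fin (2 * n))) (hI : I.card = k) :
    maxMinor (signColumns (Matrix.of fun r =>
        crossingMap a (vertexParameter c ⟨(i, j), hij⟩) (B r))) I =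
      s / diagWeight c ⟨(i, j), hij⟩ * builtMeasurement c i j I := by
  set e : StdEdge n := ⟨(i, j), hij⟩ with he
  have hij' : i.val < j.val := hij
  obtain ⟨p, hp⟩ : ∃ p : Fin (2 * n), p.val + 1 = a.val :=
    ⟨⟨a.val - 1, by omega⟩, by simp only; omega⟩
  obtain ⟨r, hr⟩ : ∃ r : Fin (2 * n), a.val + 1 = r.val := ⟨⟨a.val + 1, by omega⟩, rfl⟩
  have hd : diagWeight c e ≠ 0 := by
    unfold diagWeight
    split_ifs
    · exact hc e
    · exact one_ne_zero
  have hpar : Even (i.val + j.val) ↔ a.val % 2 = 0 := by rw [Nat.even_iff]; omega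
  -- the signs of the columns turn the transvection into the addition of `β` times the column `a`
  -- to both of its neighbours
  have hβp : bdrySign p * vertexParameter c e =
      antidiagWeight c e / diagWeight c e * bdrySign a := by
    rw [← hp, bdrySign_succ, vertexParameter, antidiagWeight, diagWeight, he]
    simp only [hpar]
    split_ifs
    · omega
    · ring
    · ring
    · omega
  have hβr : -(bdrySign r * vertexParameter c e) =
      antidiagWeight c e / diagWeight c e * bdrySign a := by
    rw [← hr, bdrySign_succ, vertexParameter, antidiagWeight, diagWeight, he]
    simp only [hpar]
    split_ifs
    · ring
    · ring
  have hadd := maxMinor_addNeighbours (signColumns B)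
    (signColumns (Matrix.of fun r => crossingMap a (vertexParameter c e) (B r)))
    (antidiagWeight c e / diagWeight c e) p a r hp hr (by
      intro row l
      simp only [signColumns, Matrix.of_apply, crossingMap_apply]
      have h1 : (l.val + 1 = a.val) ↔ l = p := by rw [Fin.ext_iff]; omega
      have h2 : (l.val = a.val + 1) ↔ l = r := by rw [Fin.ext_iff]; omega
      simp only [h1, h2]
      have hpr : p ≠ r := by rintro rfl; omega
      by_cases hl : l = p
      · subst hl
        simp only [true_or, if_true, hpr, if_false]
        rw [← mul_assoc, ← hβp]
        ring
      · by_cases hl' : l = r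
        · subst hl'
          simp only [or_true, if_true, hl, if_false]
          rw [← mul_assoc, ← hβr]
          ring
        · simp [hl, hl']) I hI
  rw [hadd, builtMeasurement_step c hij (p := p) (a := a) (r := r) (by omega) ha (by omega),
    hB I hI, ← he]
  have hins : ∀ q ∈ I, a ∉ I → (insert a (I.erase q)).card = k := by
    intro q hq haI
    rw [Finset.card_insert_of_notMem (by simp [haI]), Finset.card_erase_of_mem hq, hI]
    have : 0 < I.card := Finset.card_pos.2 ⟨q, hq⟩
    omega
  by_cases haI : a ∈ I
  · simp only [haI, if_true, add_zero]
    field_simp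
  · simp only [haI, if_false]
    by_cases h1 : p ∈ I <;> by_cases h2 : r ∈ I <;>
      simp only [h1, h2, if_true, if_false, add_zero, zero_add]
    · rw [hB _ (hins p h1 haI), hB _ (hins r h2 haI)]
      field_simp
    · rw [hB _ (hins p h1 haI)]
      field_simp
    · rw [hB _ (hins r h2 haI)]
      field_simp
    · field_simp

/-! ### The vectors of strand values -/

/-- The number (counted from `0`) of the strand at the place `k` on the top side of the network that
has the crossings `builtEdges n i j`. -/
def strandAt (n i j : ℕ) (k : Fin n) : Fin n :=
  if h : k.val + i + 1 < j ∧ i + 1 + k.val < n then ⟨i + 1 + k.val, h.2⟩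
  else if h : k.val + i + 1 = j ∧ i < n then ⟨i, h.2⟩
  else if h : i + k.val < n then ⟨i + k.val, h⟩
  else ⟨n - 1 - k.val, by omega⟩

theorem val_strandAt (n i j : ℕ) (k : Fin n) :
    (strandAt n i j k).val =
      if k.val + i + 1 < j ∧ i + 1 + k.val < n then i + 1 + k.val
      else if k.val + i + 1 = j ∧ i < n then i
      else if i + k.val < n then i + k.val
      else n - 1 - k.val := by
  unfold strandAt
  split_ifs <;> rfl

/-- The values at the `2n` strand ends of the solution with the value `1` on the end `n + x` and
the value `0` on the other ends on the right side, for the network that has the crossings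
`builtEdges n i j` and the partition function `M`. -/
def strandRow (M : Matrix (Fin n) (Fin n) ℝ) (i j : ℕ) (x : Fin n) : Fin (2 * n) → ℝ :=
  appendId (M.submatrix id (strandAt n i j)) x

theorem strandRow_of_lt (M : Matrix (Fin n) (Fin n) ℝ) (i j : ℕ) (x : Fin n) {k : Fin (2 * n)}
    (hk : k.val < n) : strandRow M i j x k = M x (strandAt n i j ⟨k.val, hk⟩) := by
  simp [strandRow, appendId, hk]

theorem strandRow_of_ge (M : Matrix (Fin n) (Fin n) ℝ) (i j : ℕ) (x : Fin n) {k : Fin (2 * n)}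
    (hk : ¬ k.val < n) : strandRow M i j x k = if k.val = n + x.val then 1 else 0 := by
  simp [strandRow, appendId, hk]

theorem mul_vertexWeight_apply (M : Matrix (Fin n) (Fin n) ℝ) {i j : Fin n} (hij : i ≠ j) (t : ℝ)
    (x l : Fin n) :
    (M * vertexWeight i j t) x l =
      if l = i then M x j - t * (M x j - M x i) else if l = j then M x i - t * (M x j - M x i)
      else M x l := by
  rw [Matrix.mul_apply]
  split_ifs with h1 h2
  · subst h1
    rw [Finset.sum_eq_add_of_mem l j (Finset.mem_univ _) (Finset.mem_univ _) hij]
    · simp only [vertexWeight, Matrix.of_apply, and_self, if_true, hij, hij.symm, and_true,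
        if_false]
      ring
    · rintro k - ⟨hk1, hk2⟩
      simp [vertexWeight, hk1, hk2]
  · subst h2
    rw [Finset.sum_eq_add_of_mem i l (Finset.mem_univ _) (Finset.mem_univ _) hij]
    · simp only [vertexWeight, Matrix.of_apply, and_self, if_true, hij, hij.symm, and_true,
        and_false, if_false]
      ring
    · rintro k - ⟨hk1, hk2⟩
      simp [vertexWeight, hk1, hk2]
  · rw [Finset.sum_eq_single l]
    · simp [vertexWeight, h1, h2]
    · intro k _ hk
      simp [vertexWeight, h1, h2, hk]
    · simp

/-- A crossing changes the values on the two strands that it swaps by the same amount. -/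
theorem strandRow_step (M : Matrix (Fin n) (Fin n) ℝ) {i j : Fin n} (hij : i < j) (t : ℝ)
    {p a : Fin (2 * n)} (hp : p.val + 1 = a.val) (ha : a.val = j.val - i.val) (x : Fin n)
    (k : Fin (2 * n)) :
    strandRow (M * vertexWeight i j t) i j x k = strandRow M i (j + 1) x k -
      if k = p ∨ k = a then
        t * (strandRow M i (j + 1) x p - strandRow M i (j + 1) x a) else 0 := by
  have hij' : i.val < j.val := hij
  have hpn : p.val < n := by omega
  have han : a.val < n := by omega
  have hp1 : strandAt n i (j + 1) ⟨p.val, hpn⟩ = j := by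
    refine Fin.ext ?_
    unfold strandAt
    rw [dif_pos (by simp only; omega)]
    simp only
    omega
  have ha1 : strandAt n i (j + 1) ⟨a.val, han⟩ = i := by
    refine Fin.ext ?_
    unfold strandAt
    rw [dif_neg (by simp only; omega), dif_pos (by simp only; omega)]
  have hp2 : strandAt n i j ⟨p.val, hpn⟩ = i := by
    refine Fin.ext ?_
    unfold strandAt
    rw [dif_neg (by simp only; omega), dif_pos (by simp only; omega)]
  have ha2 : strandAt n i j ⟨a.val, han⟩ = j := by
    refine Fin.ext ?_
    unfold strandAt
    rw [dif_neg (by simp only; omega), dif_neg (by simp only; omega),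
      dif_pos (by simp only; omega)]
    simp only
    omega
  rw [strandRow_of_lt M i (j + 1) x hpn, strandRow_of_lt M i (j + 1) x han, hp1, ha1]
  by_cases hk : k.val < n
  · rw [strandRow_of_lt _ _ _ _ hk, strandRow_of_lt _ _ _ _ hk, mul_vertexWeight_apply M hij.ne]
    by_cases h1 : k = p
    · subst h1
      rw [hp2, hp1, if_pos rfl, if_pos (Or.inl rfl)]
    · by_cases h2 : k = a
      · subst h2
        rw [ha2, ha1, if_neg hij.ne', if_pos rfl, if_pos (Or.inr rfl)]
      · have h1' : k.val ≠ p.val := fun h => h1 (Fin.ext h)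
        have h2' : k.val ≠ a.val := fun h => h2 (Fin.ext h)
        have h3 : strandAt n i j ⟨k.val, hk⟩ = strandAt n i (j + 1) ⟨k.val, hk⟩ := by
          refine Fin.ext ?_
          rw [val_strandAt, val_strandAt]
          dsimp only
          split_ifs <;> omega
        have h4 : (strandAt n i (j + 1) ⟨k.val, hk⟩).val ≠ i.val ∧
            (strandAt n i (j + 1) ⟨k.val, hk⟩).val ≠ j.val := by
          rw [val_strandAt]
          dsimp only
          split_ifs <;> omega
        rw [h3, if_neg (fun h => h4.1 (congrArg _ h)), if_neg (fun h => h4.2 (congrArg _ h)),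
          if_neg (by tauto), sub_zero]
  · have h1 : ¬ (k = p ∨ k = a) := by rintro (rfl | rfl) <;> omega
    rw [strandRow_of_ge _ _ _ _ hk, strandRow_of_ge _ _ _ _ hk, if_neg h1, sub_zero]

theorem strandAt_of_le {i j : ℕ} (hji : j ≤ i) : strandAt n i j = strandAt n i (j + 1) := by
  funext k
  refine Fin.ext ?_
  rw [val_strandAt, val_strandAt]
  split_ifs <;> omega

theorem strandAt_row {i : ℕ} (hi : i < n) : strandAt n i n = strandAt n (i + 1) 0 := by
  funext k
  refine Fin.ext ?_
  rw [val_strandAt, val_strandAt]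
  split_ifs <;> first | omega | simp_all

theorem strandAt_zero_zero : strandAt n 0 0 = id := by
  funext k
  refine Fin.ext ?_
  rw [val_strandAt, id]
  split_ifs <;> first | omega | simp_all

/-! ### The basis matrices of the partially built networks -/

/-- The rows of `B` are a basis of the space of boundary differences for the network that has the
crossings `builtEdges n i j` and the partition function `M`; they span an isotropic subspace in the
kernel of both parity sums, and up to the column signs and a common factor their maximal minors are
the boundary measurements. -/
structure IsBuiltBasis (c : StdEdge n → ℝ) (i j : ℕ) (M : Matrix (Fin n) (Fin n) ℝ)
    (B : Matrix (Fin (n - 1)) (Fin (2 * n)) ℝ) : Prop where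
  linearIndependent : LinearIndependent ℝ B.row
  span_eq : Submodule.span ℝ (Set.range B.row) =
    Submodule.span ℝ (Set.range fun x => bdryDiff n (strandRow M i j x))
  isotropic : ∀ r s, B r ⬝ᵥ (diffForm n).mulVec (B s) = 0
  parity : ∀ r s, B r ⬝ᵥ parityVec n s = 0
  minors : ∃ s : ℝ, s ≠ 0 ∧ ∀ I : Finset (Fin (2 * n)), I.card = n - 1 →
    maxMinor (signColumns B) I = s * builtMeasurement c i j I

theorem IsBuiltBasis.step {c : StdEdge n → ℝ} (hc : ∀ e, c e ≠ 0) {i j : Fin n} (hij : i < j)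
    {M : Matrix (Fin n) (Fin n) ℝ} {B : Matrix (Fin (n - 1)) (Fin (2 * n)) ℝ}
    (h : IsBuiltBasis c i (j + 1) M B) {a : Fin (2 * n)} (ha : a.val = j.val - i.val) :
    IsBuiltBasis c i j (M * vertexWeight i j (vertexParameter c ⟨(i, j), hij⟩))
      (Matrix.of fun r => crossingMap a (vertexParameter c ⟨(i, j), hij⟩) (B r)) := by
  set t := vertexParameter c ⟨(i, j), hij⟩ with ht
  have hij' : i.val < j.val := hij
  obtain ⟨p, hp⟩ : ∃ p : Fin (2 * n), p.val + 1 = a.val :=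
    ⟨⟨a.val - 1, by omega⟩, by simp only; omega⟩
  obtain ⟨r, hr⟩ : ∃ r : Fin (2 * n), r.val = a.val + 1 := ⟨⟨a.val + 1, by omega⟩, rfl⟩
  refine ⟨?_, ?_, ?_, ?_, ?_⟩
  · exact h.linearIndependent.map' (crossingMap a t)
      (LinearMap.ker_eq_bot.2 (crossingMap_injective a t))
  · have h1 : (Matrix.of fun r => crossingMap a t (B r)).row = crossingMap a t ∘ B.row := rfl
    have h2 : (fun x => bdryDiff n (strandRow (M * vertexWeight i j t) i j x)) =
        crossingMap a t ∘ fun x => bdryDiff n (strandRow M i (j + 1) x) := by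
      funext x
      exact bdryDiff_eq_crossingMap hp (by omega) (strandRow_step M hij t hp ha x)
    rw [h1, h2, Set.range_comp, Set.range_comp, ← Submodule.map_span, ← Submodule.map_span,
      h.span_eq]
  · intro x y
    exact (diffForm_crossingMap hp hr t _ _).trans (h.isotropic x y)
  · intro x s
    exact (crossingMap_dotProduct_parityVec hp hr t _ s).trans (h.parity x s)
  · obtain ⟨s, hs, hB⟩ := h.minors
    refine ⟨s / diagWeight c ⟨(i, j), hij⟩, div_ne_zero hs ?_, fun I hI => ?_⟩
    · unfold diagWeight
      split_ifs
      · exact hc _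
      · exact one_ne_zero
    · exact maxMinor_crossingMap c hc hij ha hB I hI

theorem IsBuiltBasis.congr {c : StdEdge n → ℝ} {i j i' j' : ℕ} {M : Matrix (Fin n) (Fin n) ℝ}
    {B : Matrix (Fin (n - 1)) (Fin (2 * n)) ℝ} (h : IsBuiltBasis c i j M B)
    (hs : strandAt n i j = strandAt n i' j')
    (hm : builtMeasurement c i j = builtMeasurement c i' j') : IsBuiltBasis c i' j' M B where
  linearIndependent := h.linearIndependent
  span_eq := by
    have := h.span_eq
    unfold strandRow at *
    rwa [hs] at this
  isotropic := h.isotropic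
  parity := h.parity
  minors := by
    have := h.minors
    rwa [hm] at this

/-! ### The network without crossings -/

/-- The vector `e_m - e_{2n - m}` (with indices modulo `2n`, so that it vanishes for `m = 0` and
`m = n`). -/
def arcVec (n m : ℕ) : Fin (2 * n) → ℝ := fun l =>
  (if l.val = m then 1 else 0) - if l.val + m = 2 * n ∨ l.val + m = 0 then 1 else 0

/-- The matrix with the rows `e_m - e_{2n - m}`, `m = 1, …, n - 1`. -/
def arcMatrix (n : ℕ) : Matrix (Fin (n - 1)) (Fin (2 * n)) ℝ :=
  Matrix.of fun r => arcVec n (r.val + 1)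

theorem arcMatrix_apply (r : Fin (n - 1)) (l : Fin (2 * n)) :
    arcMatrix n r l =
      (if l.val = r.val + 1 then 1 else 0) - if l.val = 2 * n - 1 - r.val then 1 else 0 := by
  have : (l.val + (r.val + 1) = 2 * n ∨ l.val + (r.val + 1) = 0) ↔ l.val = 2 * n - 1 - r.val := by
    omega
  simp only [arcMatrix, arcVec, Matrix.of_apply, this]

theorem arcMatrix_row_eq (r : Fin (n - 1)) :
    arcMatrix n r =
      Pi.single ⟨r.val + 1, by omega⟩ 1 - Pi.single ⟨2 * n - 1 - r.val, by omega⟩ 1 := by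
  funext l
  rw [arcMatrix_apply]
  simp [Pi.single_apply, Fin.ext_iff]

theorem linearIndependent_arcMatrix : LinearIndependent ℝ (arcMatrix n).row := by
  rw [Fintype.linearIndependent_iff]
  intro g hg r
  have h := congrFun hg ⟨r.val + 1, by omega⟩
  rw [Finset.sum_apply, Finset.sum_eq_single r] at h
  · have h2 : ¬ (r.val + 1 = 2 * n - 1 - r.val) := by omega
    simpa [Matrix.row_apply, arcMatrix_apply, h2] using h
  · intro s _ hs
    have h1 : ¬ (r.val = s.val) := fun h => hs (Fin.ext h.symm)
    have h2 : ¬ (r.val + 1 = 2 * n - 1 - s.val) := by omega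
    simp [Matrix.row_apply, arcMatrix_apply, h1, h2]
  · simp

theorem bdryDiff_strandRow_one (x : Fin n) :
    bdryDiff n (strandRow 1 n 0 x) = arcVec n (n - x.val) - arcVec n (n - 1 - x.val) := by
  have hv : ∀ k : Fin (2 * n), strandRow 1 n 0 x k =
      (if k.val + x.val + 1 = n then 1 else 0) + if k.val = n + x.val then 1 else 0 := by
    intro k
    by_cases hk : k.val < n
    · have h1 : strandAt n n 0 ⟨k.val, hk⟩ = ⟨n - 1 - k.val, by omega⟩ := by
        unfold strandAt
        rw [dif_neg (by omega), dif_neg (by omega), dif_neg (by omega)]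
      have h2 : (x = ⟨n - 1 - k.val, by omega⟩) ↔ k.val + x.val + 1 = n := by
        rw [Fin.ext_iff]; simp only; omega
      rw [strandRow_of_lt _ _ _ _ hk, h1, Matrix.one_apply,
        if_neg (show ¬ k.val = n + x.val by omega)]
      simp only [h2, add_zero]
    · rw [strandRow_of_ge _ _ _ _ hk, if_neg (show ¬ k.val + x.val + 1 = n by omega), zero_add]
  funext l
  rw [bdryDiff_apply, hv, hv]
  simp only [Pi.sub_apply, arcVec]
  by_cases hl : l.val = 0
  · have hq : prevPlace l = ⟨2 * n - 1, by omega⟩ := prevPlace_of_zero hl (by simp only; omega)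
    have h1 : ¬ (2 * n - 1 + x.val + 1 = n) := by omega
    have h2 : (2 * n - 1 = n + x.val) ↔ 0 = n - 1 - x.val := by omega
    have h3 : (0 + x.val + 1 = n) ↔ 0 = n - 1 - x.val := by omega
    have h4 : ¬ (0 = n + x.val) := by omega
    have h5 : ¬ (0 = n - x.val) := by omega
    have h6 : ¬ (0 + (n - x.val) = 2 * n ∨ 0 + (n - x.val) = 0) := by omega
    have h7 : (0 + (n - 1 - x.val) = 2 * n ∨ 0 + (n - 1 - x.val) = 0) ↔ 0 = n - 1 - x.val := by
      omega
    simp only [hq, hl, h1, h2, h3, h4, h5, h6, h7, if_false]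
    ring
  · have hq : prevPlace l = ⟨l.val - 1, by omega⟩ := prevPlace_of_succ (by simp only; omega)
    have h1 : (l.val - 1 + x.val + 1 = n) ↔ l.val = n - x.val := by omega
    have h2 : (l.val - 1 = n + x.val) ↔
        (l.val + (n - 1 - x.val) = 2 * n ∨ l.val + (n - 1 - x.val) = 0) := by omega
    have h3 : (l.val + x.val + 1 = n) ↔ l.val = n - 1 - x.val := by omega
    have h4 : (l.val = n + x.val) ↔
        (l.val + (n - x.val) = 2 * n ∨ l.val + (n - x.val) = 0) := by omega
    simp only [hq, h1, h2, h3, h4]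
    ring

theorem arcVec_zero : arcVec n 0 = 0 := by
  funext l
  simp only [arcVec, Pi.zero_apply]
  split_ifs <;> first | omega | norm_num

theorem arcVec_self (hn : 1 ≤ n) : arcVec n n = 0 := by
  funext l
  simp only [arcVec, Pi.zero_apply]
  split_ifs <;> first | omega | norm_num

theorem span_arcMatrix (hn : 1 ≤ n) :
    Submodule.span ℝ (Set.range (arcMatrix n).row) =
      Submodule.span ℝ (Set.range fun x => bdryDiff n (strandRow 1 n 0 x)) := by
  have hmem : ∀ m ≤ n, arcVec n m ∈ Submodule.span ℝ (Set.range (arcMatrix n).row) := by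
    intro m hm
    by_cases h0 : m = 0
    · rw [h0, arcVec_zero]
      exact Submodule.zero_mem _
    · by_cases h1 : m = n
      · rw [h1, arcVec_self hn]
        exact Submodule.zero_mem _
      · refine Submodule.subset_span ⟨⟨m - 1, by omega⟩, ?_⟩
        have : m - 1 + 1 = m := by omega
        change arcVec n (m - 1 + 1) = _
        rw [this]
  have hmem' : ∀ m ≤ n, arcVec n m ∈
      Submodule.span ℝ (Set.range fun x => bdryDiff n (strandRow 1 n 0 x)) := by
    intro m
    induction m with
    | zero => intro _; rw [arcVec_zero]; exact Submodule.zero_mem _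
    | succ m ih =>
      intro hm
      have h1 := ih (by omega)
      have h2 : arcVec n (m + 1) - arcVec n m ∈
          Submodule.span ℝ (Set.range fun x => bdryDiff n (strandRow 1 n 0 x)) := by
        refine Submodule.subset_span ⟨⟨n - 1 - m, by omega⟩, ?_⟩
        simp only [bdryDiff_strandRow_one]
        congr 2 <;> omega
      have := Submodule.add_mem _ h2 h1
      rwa [sub_add_cancel] at this
  apply le_antisymm
  · rw [Submodule.span_le]
    rintro _ ⟨r, rfl⟩
    exact hmem' (r.val + 1) (by omega)
  · rw [Submodule.span_le]
    rintro _ ⟨x, rfl⟩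
    simp only [bdryDiff_strandRow_one]
    exact Submodule.sub_mem _ (hmem _ (by omega)) (hmem _ (by omega))

theorem arcMatrix_isotropic (r s : Fin (n - 1)) :
    arcMatrix n r ⬝ᵥ (diffForm n).mulVec (arcMatrix n s) = 0 := by
  rw [arcMatrix_row_eq, arcMatrix_row_eq, Matrix.mulVec_sub, Matrix.mulVec_single_one,
    Matrix.mulVec_single_one, sub_dotProduct, single_one_dotProduct, single_one_dotProduct]
  have hr := r.2
  have hs := s.2
  simp only [Pi.sub_apply, Matrix.col_apply, diffForm, Matrix.of_apply]
  have h1 : (2 * n - 1 - r.val) % 2 = (r.val + 1) % 2 := by omega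
  have h2 : (2 * n - 1 - s.val) % 2 = (s.val + 1) % 2 := by omega
  have h3 : s.val + 1 < 2 * n - 1 - r.val := by omega
  have h4 : ¬ (2 * n - 1 - s.val < r.val + 1) := by omega
  have h5 : (2 * n - 1 - s.val < 2 * n - 1 - r.val) ↔ r.val < s.val := by omega
  have h6 : r.val + 1 < 2 * n - 1 - s.val := by omega
  have h7 : ¬ (2 * n - 1 - r.val < s.val + 1) := by omega
  have h8 : (2 * n - 1 - r.val < 2 * n - 1 - s.val) ↔ s.val < r.val := by omega
  have h9 : (s.val + 1 < r.val + 1) ↔ s.val < r.val := by omega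
  have h10 : (r.val + 1 < s.val + 1) ↔ r.val < s.val := by omega
  rw [h1, h2]
  rcases Nat.mod_two_eq_zero_or_one (r.val + 1) with hr' | hr' <;>
    rcases Nat.mod_two_eq_zero_or_one (s.val + 1) with hs' | hs' <;>
    simp only [hr', hs', true_and, false_and, zero_ne_one, one_ne_zero, if_false, sub_self,
      h3, h4, h5, h6, h7, h8, h9, h10, if_true]
  · split_ifs <;> first | omega | norm_num
  · split_ifs <;> first | omega | norm_num

theorem arcMatrix_parity (r : Fin (n - 1)) (s : ℕ) : arcMatrix n r ⬝ᵥ parityVec n s = 0 := by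
  rw [arcMatrix_row_eq, sub_dotProduct, single_one_dotProduct, single_one_dotProduct]
  have h1 : (2 * n - 1 - r.val) % 2 = (r.val + 1) % 2 := by omega
  simp [parityVec, h1]

/-- With the column signs the arcs `e_k - e_{2n - k}` get the alternating relative signs of
`det_nested`. -/
theorem bdrySign_reflect {k : ℕ} (hk : k < n) (h0 : 1 ≤ k) :
    -bdrySign (2 * n - k) = bdrySign k * (-1) ^ (n - 1 - k) := by
  have h : -((-1 : ℝ) ^ ((2 * n - k) / 2)) = (-1) ^ ((2 * n - k) / 2 + 1) := by
    rw [pow_succ]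
    ring
  unfold bdrySign
  rw [← pow_add, h]
  rw [neg_one_pow_eq_pow_mod_two, neg_one_pow_eq_pow_mod_two (n := k / 2 + (n - 1 - k))]
  congr 1
  omega

theorem maxMinor_arcMatrix (I : Finset (Fin (2 * n))) (hI : I.card = n - 1) :
    maxMinor (signColumns (arcMatrix n)) I =
      (∏ r : Fin (n - 1), bdrySign (r.val + 1)) *
        if ∀ r : Fin (n - 1), ∃ k ∈ I, k.val = r.val + 1 ∨ k.val = 2 * n - 1 - r.val
        then 1 else 0 := by
  classical
  rw [maxMinor_of_card _ hI]
  set f := I.orderEmbOfFin hI with hf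
  have hdet := det_nested (fun r : Fin (n - 1) => r.val + 1) (fun r => 2 * n - 1 - r.val)
    (fun s => (f s).val) (fun r s h => by simpa using h)
    (fun r s h => by rw [Fin.lt_def] at h; simp only; omega)
    (fun r s => by omega) (fun r s h => f.strictMono h)
  have hiff : (∀ r : Fin (n - 1), ∃ k ∈ I, k.val = r.val + 1 ∨ k.val = 2 * n - 1 - r.val) ↔
      ∀ r : Fin (n - 1), ∃ s, (f s).val = r.val + 1 ∨ (f s).val = 2 * n - 1 - r.val := by
    refine forall_congr' fun r => ?_
    constructor
    · rintro ⟨k, hk, h⟩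
      have : k ∈ Set.range f := by rw [hf, Finset.range_orderEmbOfFin]; exact hk
      obtain ⟨s, rfl⟩ := this
      exact ⟨s, h⟩
    · rintro ⟨s, h⟩
      exact ⟨f s, Finset.orderEmbOfFin_mem I hI s, h⟩
  rw [if_congr hiff rfl rfl, ← hdet, ← Matrix.det_mul_column]
  congr 1
  ext r s
  simp only [Matrix.submatrix_apply, id, signColumns, Matrix.of_apply, arcMatrix_apply]
  by_cases h1 : (f s).val = r.val + 1
  · rw [if_pos h1, if_neg (show ¬ (f s).val = 2 * n - 1 - r.val by omega), h1]
    ring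
  · by_cases h2 : (f s).val = 2 * n - 1 - r.val
    · have := bdrySign_reflect (n := n) (k := r.val + 1) (by omega) (by omega)
      rw [if_neg h1, if_pos h2, h2, show n - 1 - 1 - r.val = n - 1 - (r.val + 1) by omega,
        show 2 * n - 1 - r.val = 2 * n - (r.val + 1) by omega]
      linear_combination this
    · rw [if_neg h1, if_neg h2]
      ring

theorem builtBdry_self (k : Fin (2 * n)) :
    builtBdry n n 0 k =
      if k.val = 0 then (0, 0) else if k.val ≤ n then (n - k.val, n) else (k.val - n, n) := by
  unfold builtBdry chamber
  split_ifs <;> first | omega | rfl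

/-- Without crossings each chamber must be matched to a boundary vertex, so the boundary measurement
is `1` if `I` contains one of the two boundary vertices `m` and `2n - m` at each of the inner
chambers, and `0` otherwise. -/
theorem builtMeasurement_self (hn : 1 ≤ n) (c : StdEdge n → ℝ) (I : Finset (Fin (2 * n)))
    (hI : I.card = n - 1) :
    builtMeasurement c n 0 I =
      if ∀ r : Fin (n - 1), ∃ k ∈ I, k.val = r.val + 1 ∨ k.val = 2 * n - 1 - r.val
      then 1 else 0 := by
  classical
  have hE : builtEdges n n 0 = ∅ := by
    ext e
    simp only [builtEdges, Finset.mem_filter, Finset.mem_univ, true_and, Finset.notMem_empty,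
      iff_false]
    omega
  have hmon : ∏ k ∈ Iᶜ, (MvPolynomial.X (builtBdry n n 0 k) : MvPolynomial (ℕ × ℕ) ℝ) =
      MvPolynomial.monomial (∑ k ∈ Iᶜ, Finsupp.single (builtBdry n n 0 k) 1) 1 := by
    rw [MvPolynomial.monomial_sum_one]
    rfl
  rw [builtMeasurement, matchingSum, hE, Finset.prod_empty, one_mul, hmon,
    MvPolynomial.coeff_monomial]
  refine if_congr ?_ rfl rfl
  have hcoeff : ∀ b : ℕ × ℕ, (∑ k ∈ Iᶜ, Finsupp.single (builtBdry n n 0 k) 1 : ℕ × ℕ →₀ ℕ) b =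
      (Iᶜ.filter fun k => builtBdry n n 0 k = b).card := by
    intro b
    rw [Finsupp.finsetSum_apply]
    simp only [Finsupp.single_apply]
    rw [Finset.sum_boole, Nat.cast_id]
  constructor
  · intro h r
    by_contra hr
    push Not at hr
    have h1 : (⟨r.val + 1, by omega⟩ : Fin (2 * n)) ∉ I := fun hk => (hr _ hk).1 rfl
    have h2 : (⟨2 * n - 1 - r.val, by omega⟩ : Fin (2 * n)) ∉ I := fun hk => (hr _ hk).2 rfl
    have h3 := DFunLike.congr_fun h (n - 1 - r.val, n)
    rw [hcoeff, indicatorExp_apply] at h3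
    have h4 : 1 < (Iᶜ.filter fun k => builtBdry n n 0 k = (n - 1 - r.val, n)).card := by
      refine Finset.one_lt_card.2 ⟨⟨r.val + 1, by omega⟩, ?_, ⟨2 * n - 1 - r.val, by omega⟩, ?_, ?_⟩
      · refine Finset.mem_filter.2 ⟨Finset.mem_compl.2 h1, ?_⟩
        rw [builtBdry_self, if_neg (by simp only; omega), if_pos (by simp only; omega)]
        simp only [Prod.mk.injEq, and_true]
        omega
      · refine Finset.mem_filter.2 ⟨Finset.mem_compl.2 h2, ?_⟩
        rw [builtBdry_self, if_neg (by simp only; omega), if_neg (by simp only; omega)]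
        simp only [Prod.mk.injEq, and_true]
        omega
      · simp only [ne_eq, Fin.mk.injEq]
        omega
    split_ifs at h3 <;> omega
  · intro h
    choose g hgI hg using h
    have hginj : Function.Injective g := by
      intro r s hrs
      have h1 := hg r
      have h2 := hg s
      rw [hrs] at h1
      exact Fin.ext (by omega)
    have hIg : ∀ k, k ∈ I ↔ ∃ r, g r = k := by
      have : Finset.univ.image g = I := by
        refine Finset.eq_of_subset_of_card_le ?_ ?_
        · intro k hk
          obtain ⟨r, -, rfl⟩ := Finset.mem_image.1 hk
          exact hgI r
        · rw [Finset.card_image_of_injective _ hginj, Finset.card_fin, hI]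
      intro k
      rw [← this]
      simp
    have hnI : ∀ k, k.val = 0 ∨ k.val = n → k ∉ I := by
      intro k hk hkI
      obtain ⟨r, rfl⟩ := (hIg k).1 hkI
      have := hg r
      omega
    ext ⟨x, y⟩
    rw [hcoeff, indicatorExp_apply]
    split_ifs with hT
    · simp only [builtChambers, Finset.mem_filter, Finset.mem_product, Finset.mem_range,
        Prod.mk.injEq] at hT
      rw [Finset.card_eq_one]
      -- it remains to name the only boundary vertex outside `I` at the chamber `(x, y)`
      obtain ⟨k₀, hk₀⟩ : ∃ k₀ : Fin (2 * n), ∀ k, k ∉ I ∧ builtBdry n n 0 k = (x, y) ↔ k = k₀ := by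
        by_cases hx : x = 0
        · refine ⟨⟨y, by omega⟩, fun k => ?_⟩
          rw [builtBdry_self, Fin.ext_iff]
          constructor
          · rintro ⟨-, h⟩
            split_ifs at h <;> simp only [Prod.mk.injEq] at h ⊢ <;> omega
          · intro hk
            simp only at hk
            refine ⟨hnI k (by omega), ?_⟩
            split_ifs <;> simp only [Prod.mk.injEq] <;> omega
        · have hy : y = n := by omega
          obtain ⟨r, hrv⟩ : ∃ r : Fin (n - 1), r.val = n - x - 1 := ⟨⟨n - x - 1, by omega⟩, rfl⟩
          have hgr := hg r
          have hother : ∀ k : Fin (2 * n), k.val = n - x ∨ k.val = n + x → k ≠ g r → k ∉ I := by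
            intro k hk hkr hkI
            obtain ⟨s, rfl⟩ := (hIg k).1 hkI
            have h1 := hg s
            exact hkr (congrArg g (Fin.ext (by omega)))
          refine ⟨if (g r).val = r.val + 1 then ⟨n + x, by omega⟩ else ⟨n - x, by omega⟩,
            fun k => ?_⟩
          rw [builtBdry_self]
          constructor
          · rintro ⟨hkI, h⟩
            have hkr : k.val ≠ (g r).val := fun h => hkI ((Fin.ext h : k = g r) ▸ hgI r)
            split_ifs at h ⊢ <;> simp only [Prod.mk.injEq] at h <;>
              refine Fin.ext ?_ <;> simp only <;> omega
          · intro hk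
            have hkv : (k.val = n - x ∨ k.val = n + x) ∧ k.val ≠ (g r).val := by
              subst hk
              split_ifs
              · exact ⟨Or.inr rfl, by dsimp only; omega⟩
              · exact ⟨Or.inl rfl, by dsimp only; omega⟩
            refine ⟨hother k hkv.1 fun h => hkv.2 (congrArg _ h), ?_⟩
            split_ifs <;> simp only [Prod.mk.injEq] <;> omega
      refine ⟨k₀, ?_⟩
      ext k
      rw [Finset.mem_filter, Finset.mem_compl, Finset.mem_singleton]
      exact hk₀ k
    · rw [Finset.card_eq_zero, Finset.filter_eq_empty_iff]
      intro k _ h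
      refine hT ?_
      rw [builtBdry_self] at h
      simp only [builtChambers, Finset.mem_filter, Finset.mem_product, Finset.mem_range,
        Prod.mk.injEq]
      split_ifs at h <;> simp only [Prod.mk.injEq] at h <;> omega

theorem isBuiltBasis_arcMatrix (hn : 1 ≤ n) (c : StdEdge n → ℝ) :
    IsBuiltBasis c n 0 1 (arcMatrix n) where
  linearIndependent := linearIndependent_arcMatrix
  span_eq := span_arcMatrix hn
  isotropic := arcMatrix_isotropic
  parity := arcMatrix_parity
  minors := by
    refine ⟨∏ r : Fin (n - 1), bdrySign (r.val + 1),
      Finset.prod_ne_zero_iff.2 fun r _ => bdrySign_ne_zero _, fun I hI => ?_⟩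
    rw [maxMinor_arcMatrix I hI, builtMeasurement_self hn c I hI]

/-! ### The complete network -/

/-- A product over `m - 1, …, 0` arises by multiplication on the right with descending index. -/
theorem prod_map_reverse_finRange_induction {G : Type*} [Monoid G] {m : ℕ} (f : Fin m → G)
    (Q : ℕ → G → Prop) (hstep : ∀ (j : Fin m) (M : G), Q (j + 1) M → Q j (M * f j)) {M : G}
    (hM : Q m M) : Q 0 (M * ((List.finRange m).reverse.map f).prod) := by
  induction m generalizing M with
  | zero => simpa using hM
  | succ m ih =>
    rw [List.finRange_succ_last]
    simp only [List.reverse_append, List.reverse_singleton, List.singleton_append, List.map_cons,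
      List.prod_cons, ← List.map_reverse, List.map_map]
    rw [← mul_assoc]
    exact ih (fun j => f j.castSucc) (fun j M h => hstep j.castSucc M h) (hstep (Fin.last m) M hM)

/-- The basis matrix of the complete network, obtained by adding the crossings one by one. -/
theorem exists_isBuiltBasis (hn : 1 ≤ n) (c : StdEdge n → ℝ) (hc : ∀ e, c e ≠ 0) :
    ∃ B, IsBuiltBasis c 0 0 (boundaryPartition n c) B := by
  have houter := prod_map_reverse_finRange_induction
    (fun i : Fin n => ((List.finRange n).reverse.map fun j =>
      if h : i < j then vertexWeight i j (vertexParameter c ⟨(i, j), h⟩) else 1).prod)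
    (fun i M => ∃ B, IsBuiltBasis c i 0 M B) ?_ (M := 1) ⟨_, isBuiltBasis_arcMatrix hn c⟩
  · rwa [one_mul] at houter
  · rintro i M ⟨B, hB⟩
    refine prod_map_reverse_finRange_induction
      (fun j : Fin n => if h : i < j then vertexWeight i j (vertexParameter c ⟨(i, j), h⟩) else 1)
      (fun j M => ∃ B, IsBuiltBasis c i j M B) ?_
      ⟨B, hB.congr (strandAt_row i.2).symm (builtMeasurement_row c i.2).symm⟩
    rintro j M ⟨B, hB⟩
    by_cases hij : i < j
    · simp only [hij, dif_pos]
      have hij' : i.val < j.val := hij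
      exact ⟨_, hB.step hc hij (a := ⟨j.val - i.val, by omega⟩) rfl⟩
    · simp only [hij, dif_neg, not_false_eq_true, mul_one]
      have hji : j.val ≤ i.val := not_lt.1 hij
      exact ⟨B, hB.congr (strandAt_of_le hji).symm (builtMeasurement_of_le c hji i.2.le).symm⟩

/-! ### From boundary differences to the coordinates of `W₂` -/

/-- The boundary place whose difference is the coordinate `l` of the vectors in `W₂`: the first `n`
coordinates belong to the odd places (counted from `0`), the last `n` to the even ones. -/
def placeOfCoord (n : ℕ) : Fin (2 * n) ≃ Fin (2 * n) where
  toFun l := ⟨if l.val < n then 2 * l.val + 1 else 2 * (l.val - n), by split_ifs <;> omega⟩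
  invFun k := ⟨if k.val % 2 = 1 then k.val / 2 else n + k.val / 2, by split_ifs <;> omega⟩
  left_inv l := by
    refine Fin.ext ?_
    dsimp only
    split_ifs <;> omega
  right_inv k := by
    refine Fin.ext ?_
    dsimp only
    split_ifs <;> omega

theorem val_placeOfCoord (l : Fin (2 * n)) :
    (placeOfCoord n l).val = if l.val < n then 2 * l.val + 1 else 2 * (l.val - n) := rfl

theorem val_prevPlace (k : Fin (2 * n)) :
    (prevPlace k).val = if k.val = 0 then 2 * n - 1 else k.val - 1 := by
  split_ifs with h
  · rw [prevPlace_of_zero (p := ⟨2 * n - 1, by omega⟩) h (by dsimp only; omega)]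
  · rw [prevPlace_of_succ (p := ⟨k.val - 1, by omega⟩) (by dsimp only; omega)]

theorem vecMul_cyclicDiff (v : Fin (2 * n) → ℝ) (a : Fin (2 * n)) :
    Matrix.vecMul v (cyclicDiff (2 * n)) (prevPlace a) = bdryDiff n v a := by
  have h : ∀ i : Fin (2 * n), i.val = ((prevPlace a).val + 1) % (2 * n) ↔ i = a := by
    intro i
    rw [Fin.ext_iff]
    have : ((prevPlace a).val + 1) % (2 * n) = a.val := by
      rw [val_prevPlace]
      split_ifs with h0
      · rw [show 2 * n - 1 + 1 = 2 * n by omega, Nat.mod_self, h0]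
      · rw [Nat.mod_eq_of_lt (by omega)]
        omega
    rw [this]
  simp only [Matrix.vecMul, dotProduct, cyclicDiff, Matrix.of_apply, h, mul_sub,
    Finset.sum_sub_distrib]
  simp [bdryDiff_apply]

theorem shuffle_apply (k l : Fin (2 * n)) :
    shuffle n k l = if k = prevPlace (placeOfCoord n l) then 1 else 0 := by
  obtain ⟨u, hmod, hu⟩ : ∃ u, (k.val / 2 + 1) % n = u ∧
      (k.val / 2 + 1 = n ∧ u = 0 ∨ k.val / 2 + 1 ≠ n ∧ u = k.val / 2 + 1) := by
    by_cases h : k.val / 2 + 1 = n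
    · exact ⟨0, by rw [h, Nat.mod_self], Or.inl ⟨h, rfl⟩⟩
    · exact ⟨_, Nat.mod_eq_of_lt (by omega), Or.inr ⟨h, rfl⟩⟩
  rw [shuffle, Matrix.of_apply, hmod]
  have hp := val_prevPlace (placeOfCoord n l)
  have ho := val_placeOfCoord l
  have hk := k.2
  have hl := l.2
  by_cases h0 : k.val % 2 = 0
  · rw [if_pos h0]
    refine if_congr ?_ rfl rfl
    rw [Fin.ext_iff]
    split_ifs at hp ho <;> omega
  · rw [if_neg h0]
    refine if_congr ?_ rfl rfl
    rw [Fin.ext_iff]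
    split_ifs at hp ho <;> omega

theorem signedShuffle_apply (k l : Fin (2 * n)) :
    signedShuffle n k l = if k = placeOfCoord n l then bdrySign k else 0 := by
  have hk := k.2
  have hl := l.2
  rw [signedShuffle, Matrix.of_apply, bdrySign]
  by_cases h0 : k.val % 2 = 0
  · rw [if_pos h0]
    refine if_congr ?_ rfl rfl
    rw [Fin.ext_iff, val_placeOfCoord]
    split_ifs <;> omega
  · rw [if_neg h0]
    refine if_congr ?_ rfl rfl
    rw [Fin.ext_iff, val_placeOfCoord]
    split_ifs <;> omega

theorem vecMul_signedShuffle (x : Fin (2 * n) → ℝ) (l : Fin (2 * n)) :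
    Matrix.vecMul x (signedShuffle n) l =
      x (placeOfCoord n l) * bdrySign (placeOfCoord n l).val := by
  simp [Matrix.vecMul, dotProduct, signedShuffle_apply]

theorem isUnit_signedShuffle (n : ℕ) : IsUnit (signedShuffle n) := by
  rw [← Matrix.vecMul_injective_iff_isUnit]
  intro x y h
  funext k
  have := congrFun h ((placeOfCoord n).symm k)
  simp only [vecMul_signedShuffle, Equiv.apply_symm_apply] at this
  exact mul_right_cancel₀ (bdrySign_ne_zero _) this

theorem W₂_eq_map (c : StdEdge n → ℝ) :
    W₂ n c = (Submodule.span ℝ (Set.range fun x =>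
      bdryDiff n (strandRow (boundaryPartition n c) 0 0 x))).map
        (LinearMap.funLeft ℝ ℝ (placeOfCoord n)) := by
  rw [W₂, Submodule.map_span, ← Set.range_comp]
  congr 2
  funext x l
  have h1 : (appendId (boundaryPartition n c) * cyclicDiff (2 * n) * shuffle n).row x l =
      Matrix.vecMul (Matrix.vecMul (appendId (boundaryPartition n c) x) (cyclicDiff (2 * n)))
        (shuffle n) l := by
    rw [Matrix.row_apply, Matrix.mul_apply_eq_vecMul, Matrix.mul_apply_eq_vecMul]
  have h2 : strandRow (boundaryPartition n c) 0 0 x = appendId (boundaryPartition n c) x := by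
    rw [strandRow, strandAt_zero_zero]
    rfl
  rw [h1, Function.comp_apply, LinearMap.funLeft_apply, h2, ← vecMul_cyclicDiff]
  simp [Matrix.vecMul, dotProduct, shuffle_apply]

theorem map_signedShuffle {k : ℕ} (B : Matrix (Fin k) (Fin (2 * n)) ℝ) :
    (Submodule.span ℝ (Set.range (signColumns B).row)).map (signedShuffle n).vecMulLinear =
      (Submodule.span ℝ (Set.range B.row)).map (LinearMap.funLeft ℝ ℝ (placeOfCoord n)) := by
  rw [Submodule.map_span, Submodule.map_span, ← Set.range_comp, ← Set.range_comp]
  congr 2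
  funext r l
  simp only [Function.comp_apply, Matrix.vecMulLinear_apply, vecMul_signedShuffle,
    LinearMap.funLeft_apply, Matrix.row_apply, signColumns, Matrix.of_apply]
  rw [mul_right_comm, bdrySign_mul_self, one_mul]

/-! ### The symplectic space `V'` -/

theorem lambdaForm_eq_submatrix (n : ℕ) :
    lambdaForm n = (diffForm n).submatrix (placeOfCoord n) (placeOfCoord n) := by
  ext k l
  have hk := k.2
  have hl := l.2
  simp only [lambdaForm, diffForm, Matrix.submatrix_apply, Matrix.of_apply, val_placeOfCoord]
  by_cases h1 : k.val < n <;> by_cases h2 : l.val < n <;>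
    simp only [h1, h2, if_true, if_false, true_and, false_and] <;>
    split_ifs <;> first | rfl | omega

theorem dotProduct_lambdaForm (x y : Fin (2 * n) → ℝ) :
    (x ∘ placeOfCoord n) ⬝ᵥ (lambdaForm n).mulVec (y ∘ placeOfCoord n) =
      x ⬝ᵥ (diffForm n).mulVec y := by
  rw [lambdaForm_eq_submatrix, Matrix.submatrix_mulVec_equiv, Function.comp_assoc,
    Equiv.self_comp_symm, Function.comp_id, comp_equiv_dotProduct_comp_equiv]

theorem comp_placeOfCoord_mem_V' (x : Fin (2 * n) → ℝ) :
    x ∘ placeOfCoord n ∈ V' n ↔ x ⬝ᵥ parityVec n 1 = 0 ∧ x ⬝ᵥ parityVec n 0 = 0 := by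
  have h1 : ∑ k : Fin (2 * n) with k.val < n, (x ∘ placeOfCoord n) k = x ⬝ᵥ parityVec n 1 := by
    rw [← comp_equiv_dotProduct_comp_equiv _ _ (placeOfCoord n), Finset.sum_filter]
    refine Finset.sum_congr rfl fun k _ => ?_
    have hv := val_placeOfCoord k
    simp only [Function.comp_apply, parityVec]
    by_cases h : k.val < n
    · rw [if_pos h] at hv
      rw [if_pos h, if_pos (by omega), mul_one]
    · rw [if_neg h] at hv
      rw [if_neg h, if_neg (by omega), mul_zero]
  have h2 : ∑ k : Fin (2 * n) with n ≤ k.val, (x ∘ placeOfCoord n) k = x ⬝ᵥ parityVec n 0 := by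
    rw [← comp_equiv_dotProduct_comp_equiv _ _ (placeOfCoord n), Finset.sum_filter]
    refine Finset.sum_congr rfl fun k _ => ?_
    have hv := val_placeOfCoord k
    simp only [Function.comp_apply, parityVec]
    by_cases h : k.val < n
    · rw [if_pos h] at hv
      rw [if_neg (by omega), if_neg (by omega), mul_zero]
    · rw [if_neg h] at hv
      rw [if_pos (by omega), if_pos (by omega), mul_one]
  rw [← h1, ← h2]
  rfl

theorem eq_zero_of_dotProduct_parityVec {x : Fin (2 * n) → ℝ} {a : Fin (2 * n)}
    (hx : ∀ k, k ≠ a → k.val % 2 = a.val % 2 → x k = 0)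
    (h : x ⬝ᵥ parityVec n (a.val % 2) = 0) : x a = 0 := by
  rw [dotProduct, Finset.sum_eq_single a] at h
  · simpa [parityVec] using h
  · intro k _ hk
    by_cases hp : k.val % 2 = a.val % 2
    · rw [hx k hk hp, zero_mul]
    · simp [parityVec, hp]
  · simp

/-- The form `λ_{2n}` is nondegenerate on `V'`: pairing with `e_{a - 1} - e_{a + 1}` gives the
difference at the place `a`, and the differences at the first and the last place are then determined
by the parity sums. -/
theorem lambdaForm_separating {y : Fin (2 * n) → ℝ} (hy : y ∈ V' n)
    (h : ∀ z ∈ V' n, y ⬝ᵥ (lambdaForm n).mulVec z = 0) : y = 0 := by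
  obtain ⟨x, rfl⟩ : ∃ x, y = x ∘ placeOfCoord n :=
    ⟨y ∘ (placeOfCoord n).symm, by rw [Function.comp_assoc]; simp⟩
  rw [comp_placeOfCoord_mem_V'] at hy
  have hmid : ∀ a : Fin (2 * n), 1 ≤ a.val → a.val + 1 < 2 * n → x a = 0 := by
    intro a h1 h2
    have hp : (⟨a.val - 1, by omega⟩ : Fin (2 * n)).val + 1 = a.val := by dsimp only; omega
    have hr : (⟨a.val + 1, h2⟩ : Fin (2 * n)).val = a.val + 1 := rfl
    have hpr : (a.val - 1) % 2 = (a.val + 1) % 2 := by omega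
    have hz := h ((Pi.single ⟨a.val - 1, by omega⟩ 1 - Pi.single ⟨a.val + 1, h2⟩ 1) ∘
      placeOfCoord n) (by
        rw [comp_placeOfCoord_mem_V', sub_dotProduct, sub_dotProduct, single_one_dotProduct,
          single_one_dotProduct, single_one_dotProduct, single_one_dotProduct]
        simp [parityVec, hpr])
    rwa [dotProduct_lambdaForm, diffForm_mulVec_single_sub_single hp hr, dotProduct_single_one]
      at hz
  have hx : x = 0 := by
    funext a
    by_cases h1 : 1 ≤ a.val
    · by_cases h2 : a.val + 1 < 2 * n
      · exact hmid a h1 h2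
      · have ha : a.val % 2 = 1 := by omega
        refine eq_zero_of_dotProduct_parityVec (fun k hk hp => hmid k (by omega) ?_) (ha ▸ hy.1)
        have : k.val ≠ a.val := fun h => hk (Fin.ext h)
        omega
    · have ha : a.val % 2 = 0 := by omega
      refine eq_zero_of_dotProduct_parityVec (fun k hk hp => hmid k ?_ (by omega)) (ha ▸ hy.2)
      have : k.val ≠ a.val := fun h => hk (Fin.ext h)
      omega
  rw [hx]
  rfl

theorem lambdaForm_antisymm (x y : Fin (2 * n) → ℝ) :
    x ⬝ᵥ (lambdaForm n).mulVec y = -(y ⬝ᵥ (lambdaForm n).mulVec x) := by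
  have h : (lambdaForm n).transpose = -lambdaForm n := by
    ext k l
    simp only [lambdaForm, Matrix.transpose_apply, Matrix.neg_apply, Matrix.of_apply]
    split_ifs <;> first | omega | simp
  rw [Matrix.dotProduct_mulVec, ← Matrix.mulVec_transpose, h, Matrix.neg_mulVec, neg_dotProduct,
    dotProduct_comm]

theorem finrank_V'_le (hn : 1 ≤ n) : Module.finrank ℝ (V' n) ≤ 2 * n - 2 := by
  let φ : (Fin (2 * n) → ℝ) →ₗ[ℝ] ℝ × ℝ :=
    { toFun := fun v => (∑ k with k.val < n, v k, ∑ k with n ≤ k.val, v k)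
      map_add' := fun v w => by simp [Finset.sum_add_distrib]
      map_smul' := fun s v => by simp [Finset.mul_sum] }
  have hker : V' n = LinearMap.ker φ := by
    ext v
    rw [LinearMap.mem_ker]
    exact Prod.mk_eq_zero.symm
  have hrange : LinearMap.range φ = ⊤ := by
    rw [LinearMap.range_eq_top]
    rintro ⟨s, t⟩
    refine ⟨fun k => if k.val = 0 then s else if k.val = n then t else 0, Prod.ext ?_ ?_⟩
    · change ∑ k : Fin (2 * n) with k.val < n, _ = s
      rw [Finset.sum_eq_single ⟨0, by omega⟩]
      · simp
      · intro k hk hk0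
        rw [if_neg (fun h => hk0 (Fin.ext h)), if_neg (ne_of_lt (Finset.mem_filter.1 hk).2)]
      · intro h
        exact absurd (Finset.mem_filter.2 ⟨Finset.mem_univ _, by dsimp only; omega⟩) h
    · change ∑ k : Fin (2 * n) with n ≤ k.val, _ = t
      rw [Finset.sum_eq_single ⟨n, by omega⟩]
      · rw [if_neg (by dsimp only; omega), if_pos rfl]
      · intro k hk hk0
        have := (Finset.mem_filter.1 hk).2
        rw [if_neg (by omega), if_neg (fun h => hk0 (Fin.ext h))]
      · intro h
        exact (h (Finset.mem_filter.2 ⟨Finset.mem_univ _, le_refl n⟩)).elim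
  have := φ.finrank_range_add_finrank_ker
  rw [hrange, finrank_top, Module.finrank_prod, Module.finrank_self, Module.finrank_fin_fun] at this
  rw [hker]
  omega

theorem finrank_le_of_isIsotropic (hn : 1 ≤ n) {W : Submodule ℝ (Fin (2 * n) → ℝ)}
    (hWV : W ≤ V' n) (hW : IsIsotropic (lambdaForm n) W) : Module.finrank ℝ W ≤ n - 1 := by
  let b : LinearMap.BilinForm ℝ (V' n) :=
    LinearMap.BilinForm.restrict (Matrix.toBilin' (lambdaForm n)) (V' n)
  have hb : ∀ x y : V' n, b x y = x.1 ⬝ᵥ (lambdaForm n).mulVec y.1 := fun x y =>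
    Matrix.toBilin'_apply' (lambdaForm n) x.1 y.1
  have hnd : b.Nondegenerate := by
    constructor
    · intro y h
      refine Subtype.ext (lambdaForm_separating y.2 fun z hz => ?_)
      rw [← h ⟨z, hz⟩, hb]
    · intro y h
      refine Subtype.ext (lambdaForm_separating y.2 fun z hz => ?_)
      rw [lambdaForm_antisymm, neg_eq_zero, ← h ⟨z, hz⟩, hb]
  have hle : W.comap (V' n).subtype ≤ b.orthogonal (W.comap (V' n).subtype) := by
    intro y hy
    rw [LinearMap.BilinForm.mem_orthogonal_iff]
    intro z hz
    rw [hb]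
    exact hW _ hz _ hy
  have h1 := Submodule.finrank_mono hle
  rw [LinearMap.BilinForm.finrank_orthogonal hnd] at h1
  have h2 : Module.finrank ℝ (W.comap (V' n).subtype) = Module.finrank ℝ W :=
    (Submodule.comapSubtypeEquivOfLe hWV).finrank_eq
  have h3 := finrank_V'_le hn
  omega

theorem isIsotropic_span {ι : Type} {m : ℕ} (ω : Matrix (Fin m) (Fin m) ℝ) (v : ι → Fin m → ℝ)
    (h : ∀ r s, v r ⬝ᵥ ω.mulVec (v s) = 0) : IsIsotropic ω (Submodule.span ℝ (Set.range v)) := by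
  intro x hx y hy
  induction hx using Submodule.span_induction with
  | mem x hx =>
    obtain ⟨r, rfl⟩ := hx
    induction hy using Submodule.span_induction with
    | mem y hy => obtain ⟨s, rfl⟩ := hy; exact h r s
    | zero => simp
    | add y z _ _ hy hz => rw [Matrix.mulVec_add, dotProduct_add, hy, hz, add_zero]
    | smul a y _ hy => rw [Matrix.mulVec_smul, dotProduct_smul, hy, smul_zero]
  | zero => simp
  | add x z _ _ hx hz => rw [add_dotProduct, hx, hz, add_zero]
  | smul a x _ hx => rw [smul_dotProduct, hx, smul_zero]

theorem W₂_mem_lagrangianGrassmannian (hn : 1 ≤ n) {c : StdEdge n → ℝ} (hc : ∀ e, c e ≠ 0) :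
    W₂ n c ∈ lagrangianGrassmannian (lambdaForm n) (n - 1) (V' n) := by
  obtain ⟨B, hB⟩ := exists_isBuiltBasis hn c hc
  have hW : W₂ n c = Submodule.span ℝ (Set.range fun r => B r ∘ placeOfCoord n) := by
    rw [W₂_eq_map, ← hB.span_eq, Submodule.map_span, ← Set.range_comp]
    rfl
  have hli : LinearIndependent ℝ fun r => B r ∘ placeOfCoord n :=
    hB.linearIndependent.map' (LinearMap.funLeft ℝ ℝ (placeOfCoord n))
      (LinearMap.ker_eq_bot.2 (LinearMap.funLeft_injective_of_surjective _ _ _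
        (placeOfCoord n).surjective))
  have hfin : Module.finrank ℝ (W₂ n c) = n - 1 := by
    rw [hW, finrank_span_eq_card hli, Fintype.card_fin]
  refine ⟨?_, ?_, hfin, ?_⟩
  · rw [hW, Submodule.span_le]
    rintro _ ⟨r, rfl⟩
    exact (comp_placeOfCoord_mem_V' _).2 ⟨hB.parity r 1, hB.parity r 0⟩
  · rw [hW]
    refine isIsotropic_span _ _ fun r s => ?_
    rw [dotProduct_lambdaForm]
    exact hB.isotropic r s
  · intro W' hle hV hiso
    refine (Submodule.eq_of_le_of_finrank_le hle ?_).symm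
    rw [hfin]
    exact finrank_le_of_isIsotropic hn hV hiso

theorem exists_isLamPoint (hn : 1 ≤ n) {c : StdEdge n → ℝ} (hc : ∀ e, c e ≠ 0) :
    ∃ X, IsLamPoint (stdNetwork n c) X ∧ X.map (signedShuffle n).vecMulLinear = W₂ n c := by
  obtain ⟨B, hB⟩ := exists_isBuiltBasis hn c hc
  obtain ⟨s, hs, hmin⟩ := hB.minors
  refine ⟨Submodule.span ℝ (Set.range (signColumns B).row),
    ⟨signColumns B, ?_, rfl, s, hs, fun I hI => ?_⟩, ?_⟩
  · rw [Fintype.linearIndependent_iff]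
    intro g hg
    refine Fintype.linearIndependent_iff.1 hB.linearIndependent g ?_
    funext l
    have h := congrFun hg l
    simp only [Finset.sum_apply, Pi.smul_apply, Matrix.row_apply, signColumns, Matrix.of_apply,
      smul_eq_mul, Pi.zero_apply] at h ⊢
    refine (mul_eq_zero.1 ?_).resolve_left (bdrySign_ne_zero l.val)
    rw [← h, Finset.mul_sum]
    exact Finset.sum_congr rfl fun r _ => by ring
  · rw [← maxMinor_of_card _ hI, hmin I hI, builtMeasurement_zero_zero hn]
  · rw [map_signedShuffle, hB.span_eq, W₂_eq_map]

end ElectricalLG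

end

open ElectricalLG in
theorem corollary8p2 (n : ℕ) (hn : 1 ≤ n) :
    (∀ c : StdEdge n → ℝ, (∀ e, c e ≠ 0) →
      W₂ n c ∈ lagrangianGrassmannian (lambdaForm n) (n - 1) (V' n)) ∧
    IsUnit (signedShuffle n) ∧
    (∀ c : StdEdge n → ℝ, (∀ e, 0 < c e) →
      (∃! X : Submodule ℝ (Fin (2 * n) → ℝ), IsLamPoint (stdNetwork n c) X) ∧
      ∀ X : Submodule ℝ (Fin (2 * n) → ℝ), IsLamPoint (stdNetwork n c) X →
        X.map (signedShuffle n).vecMulLinear = W₂ n c) := by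
  refine ⟨fun c hc => W₂_mem_lagrangianGrassmannian hn hc, isUnit_signedShuffle n, fun c hc => ?_⟩
  obtain ⟨X, hX, hXW⟩ := exists_isLamPoint hn fun e => (hc e).ne'
  refine ⟨⟨X, hX, fun Y hY => HasPluckerCoordinates.unique hY hX⟩, fun Y hY => ?_⟩
  rw [HasPluckerCoordinates.unique hY hX, hXW]
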